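/- **Setting.** Let $F$ be a field containing $\mathbb C$ (the field of functions of the spectral variable $n$ in which the spectral terms lie, for instance the meromorphic functions on a connected domain). Consider a $2\times2$ Lax pair $\theta(l+1,m)=L(l,m)\theta(l,m)$, $\theta(l,m+1)=M(l,m)\theta(l,m)$, $(l,m)\in\mathbb Z^2$, with $$L=\begin{pmatrix}aA&bB\\ cC&dD\end{pmatrix},\qquad M=\begin{pmatrix}\alpha\Lambda&\beta\Xi\\ \gamma\Gamma&\delta\Delta\end{pmatrix},$$ where the eight spectral terms $A,B,C,D,\Lambda,\Xi,\Gamma,\Delta$ are given nonzero elements of $F$ and the eight lattice terms $a,b,c,d,\alpha,\beta,\gamma,\delta$ are unknown nowhere zero functions $\mathbb Z^2\to\mathbb C$. The *system* of the Lax pair is the system of lattice equations that is equivalent to $L(l,m+1)M(l,m)=M(l+1,m)L(l,m)$ holding identically in the spectral variable; each matrix entry contributes as many equations as there are $\mathbb C$-linearly independent ones among the spectral products occurring in that entry. A *gauge transformation* is $L(l,m)\mapsto G(l+1,m)L(l,m)G(l,m)^{-1}$, $M(l,m)\mapsto G(l,m+1)M(l,m)G(l,m)^{-1}$ with $G=\operatorname{diag}(g_0,g_1)$,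 $g_i:\mathbb Z^2\to\mathbb C\setminus\{0\}$; it removes two of the eight lattice terms. The system is called * *trivial* if it has a solution and is equivalent, for nowhere zero lattice terms, to a system of multiplicatively linear equations, that is, equations each prescribing the value of a Laurent monomial in finitely many values of the lattice terms; * *underdetermined* if at least three of the lattice terms (more than can be removed by gauge transformations) can be prescribed as arbitrary nowhere zero functions in a solution; * *overdetermined* if it consists of more than $6=8-2$ equations and, moreover, there is a nonzero polynomial $P$ in eight variables such that on every elementary square the equations for nonzero values force $P=0$ at the eight unshifted values $a,b,c,d,\alpha,\beta,\gamma,\delta$. With $\bar x=x(l+1,m)$, $\hat x=x(l,m+1)$, nowhere zero parameter functions $\lambda_i=\lambda_i(l)$, $\mu_i=\mu_i(m)$, and $\rho=\lambda_3^{(-1)^m}$, $\sigma=\mu_3^{(-1)^l}$, let LSG$_2$ be $$\frac{\rho}{\sigma}\frac{\hat x}{x}+\lambda_1\mu_1\hat{\bar x}\hat y=\frac{\sigma}{\rho}\frac{\hat{\bar x}}{\bar x}+\frac{\lambda_2\mu_2}{x\bar y},\qquad \frac{\sigma}{\rho}\frac{\hat{\bar y}}{\hat y}+\frac{\lambda_2\mu_2}{\hat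 x y}=\frac{\rho}{\sigma}\frac{\bar y}{y}+\lambda_1\mu_1\bar x\hat{\bar y},$$ and let LMKdV$_2$ be $$\frac{\lambda_1}{\sigma}\frac{\hat{\bar x}}{\hat x}+\frac{\mu_2}{\rho}\frac{y}{\hat y}=\lambda_2\sigma\frac{y}{\bar y}+\rho\mu_1\frac{\hat{\bar x}}{\bar x},\qquad \rho\mu_1\hat x\hat{\bar y}+\lambda_2\sigma x\hat y=\frac{\mu_2}{\rho}x\bar y+\frac{\lambda_1}{\sigma}\bar x\hat{\bar y}.$$ The system is *reducible to* LSG$_2$ (resp. LMKdV$_2$) if, after absorbing a nonzero constant into each lattice term, its solutions are exactly the gauge transforms of the lattice terms $$\begin{pmatrix}a&b\\c&d\end{pmatrix}=\begin{pmatrix}1/\rho&\lambda_1\bar x\\ \lambda_2/x&\rho\bar y/y\end{pmatrix},\quad \begin{pmatrix}\alpha&\beta\\\gamma&\delta\end{pmatrix}=\begin{pmatrix}\hat x/(\sigma x)&\mu_2/y\\ \mu_1\hat y&\sigma\end{pmatrix}$$ resp. $$\begin{pmatrix}a&b\\c&d\end{pmatrix}=\begin{pmatrix}\lambda_1\bar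 x/x&\rho/y\\ \bar y/\rho&\lambda_2\end{pmatrix},\quad \begin{pmatrix}\alpha&\beta\\\gamma&\delta\end{pmatrix}=\begin{pmatrix}\mu_1\hat x/x&1/(\sigma y)\\ \sigma\hat y&\mu_2\end{pmatrix}$$ with arbitrary nowhere zero parameter functions $\lambda_1,\lambda_2,\lambda_3,\mu_1,\mu_2,\mu_3$ and nowhere zero $x,y:\mathbb Z^2\to\mathbb C$ solving LSG$_2$ (resp. LMKdV$_2$). **Theorem.** For every choice of the eight nonzero spectral terms, the system is trivial, underdetermined, overdetermined, or reducible to LSG$_2$ or to LMKdV$_2$. -/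

import Mathlib

noncomputable section

namespace LaxClass

/-- The eight positions of a pair of `2 × 2` matrices: `inl (i, j)` is the `(i, j)` entry of `L`,
`inr (i, j)` is the `(i, j)` entry of `M`. -/
abbrev Slot : Type := (Fin 2 × Fin 2) ⊕ (Fin 2 × Fin 2)

/-- The matrix `L` of an 8-tuple of entries. -/
def matL {R : Type*} (v : Slot → R) : Matrix (Fin 2) (Fin 2) R :=
  Matrix.of fun i j => v (Sum.inl (i, j))

/-- The matrix `M` of an 8-tuple of entries. -/
def matM {R : Type*} (v : Slot → R) : Matrix (Fin 2) (Fin 2) R :=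
  Matrix.of fun i j => v (Sum.inr (i, j))

/-- The eight separable entries (lattice factor times spectral factor). The spectral factors lie in
a field `F` of functions of the spectral variable, containing the constants `ℂ`. -/
def separable {F : Type*} [Field F] [Algebra ℂ F] (s : Slot → F) (v : Slot → ℂ) : Slot → F :=
  fun k => algebraMap ℂ F (v k) * s k

/-- The compatibility condition `L(l,m+1) M(l,m) = M(l+1,m) L(l,m)` on one elementary square, as an
identity in the spectral variable: `v`, `vHat`, `vBar` are the lattice factors at
`(l,m)`, `(l,m+1)`, `(l+1,m)`. -/
def QuadCompatible {F : Type*} [Field F] [Algebra ℂ F] (s : Slot → F)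
    (v vHat vBar : Slot → ℂ) : Prop :=
  matL (separable s vHat) * matM (separable s v) = matM (separable s vBar) * matL (separable s v)

/-- The lattice factors `u l m : Slot → ℂ` are nowhere zero and solve the system of lattice
equations arising from the compatibility condition of the Lax pair with spectral factors `s`. -/
def IsSolution {F : Type*} [Field F] [Algebra ℂ F] (s : Slot → F) (u : ℤ → ℤ → Slot → ℂ) : Prop :=
  (∀ l m k, u l m k ≠ 0) ∧ ∀ l m, QuadCompatible s (u l m) (u l (m + 1)) (u (l + 1) m)

/-- The number of lattice equations arising from the compatibility condition: every entry gives one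
equation for each linearly independent spectral term that occurs in it. -/
def numEquations {F : Type*} [Field F] [Algebra ℂ F] (s : Slot → F) : ℕ :=
  ∑ i : Fin 2, ∑ j : Fin 2,
    Module.finrank ℂ (Submodule.span ℂ
      (Set.range (fun k => matL s i k * matM s k j) ∪
        Set.range (fun k => matM s i k * matL s k j)))

/-- Trivial: there are solutions, and the system is equivalent to a system of equations that are
all linear (in the multiplicative sense), i.e. which prescribe Laurent monomials in the
values of the lattice terms. -/
def Trivial {F : Type*} [Field F] [Algebra ℂ F] (s : Slot → F) : Prop :=
  (∃ u, IsSolution s u) ∧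
    ∃ E : Set ((ℤ × ℤ × Slot →₀ ℤ) × ℂ), ∀ u : ℤ → ℤ → Slot → ℂ, (∀ l m k, u l m k ≠ 0) →
      (IsSolution s u ↔ ∀ e ∈ E, e.1.prod (fun q n => u q.1 q.2.1 q.2.2 ^ n) = e.2)

/-- Underdetermined: more lattice terms than the two that can be removed by (diagonal) gauge
transformations remain free, i.e. can be prescribed as arbitrary nowhere zero functions. -/
def Underdetermined {F : Type*} [Field F] [Algebra ℂ F] (s : Slot → F) : Prop :=
  ∃ T : Finset Slot, 2 < T.card ∧
    ∀ f : ℤ → ℤ → Slot → ℂ, (∀ l m k, f l m k ≠ 0) →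
      ∃ u, IsSolution s u ∧ ∀ l m, ∀ k ∈ T, u l m k = f l m k

/-- Overdetermined: there are more equations than the `6 = 8 - 2` lattice terms that are left after
gauge transformations, and the surplus is genuine: elimination of the shifted terms
on an elementary square leaves a nonzero polynomial equation between the eight unshifted terms. -/
def Overdetermined {F : Type*} [Field F] [Algebra ℂ F] (s : Slot → F) : Prop :=
  8 - 2 < numEquations s ∧
    ∃ P : MvPolynomial Slot ℂ, P ≠ 0 ∧
      ∀ v vHat vBar : Slot → ℂ, (∀ k, v k ≠ 0) → (∀ k, vHat k ≠ 0) → (∀ k, vBar k ≠ 0) →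
        QuadCompatible s v vHat vBar → MvPolynomial.eval v P = 0

/-- The diagonal gauge transformation `θ ↦ diag(g₀, g₁) θ` acting on the lattice terms. -/
def gauge (g : ℤ → ℤ → Fin 2 → ℂ) (u : ℤ → ℤ → Slot → ℂ) : ℤ → ℤ → Slot → ℂ :=
  fun l m => Sum.elim
    (fun p => g (l + 1) m p.1 * u l m (Sum.inl p) / g l m p.2)
    (fun p => g l (m + 1) p.1 * u l m (Sum.inr p) / g l m p.2)

/-- Parameter functions `λ₁, λ₂, λ₃` of `l` and `μ₁, μ₂, μ₃` of `m`, nowhere zero. -/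
structure Params where
  lam1 : ℤ → ℂ
  lam2 : ℤ → ℂ
  lam3 : ℤ → ℂ
  mu1 : ℤ → ℂ
  mu2 : ℤ → ℂ
  mu3 : ℤ → ℂ
  lam1_ne : ∀ l, lam1 l ≠ 0
  lam2_ne : ∀ l, lam2 l ≠ 0
  lam3_ne : ∀ l, lam3 l ≠ 0
  mu1_ne : ∀ m, mu1 m ≠ 0
  mu2_ne : ∀ m, mu2 m ≠ 0
  mu3_ne : ∀ m, mu3 m ≠ 0

/-- `ρ = λ₃(l) ^ ((-1) ^ m)`. -/
def Params.rho (p : Params) (l m : ℤ) : ℂ := p.lam3 l ^ (m.negOnePow : ℤ)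

/-- `σ = μ₃(m) ^ ((-1) ^ l)`. -/
def Params.sigma (p : Params) (l m : ℤ) : ℂ := p.mu3 m ^ (l.negOnePow : ℤ)

/-- The pair of lattice equations LSG₂. -/
def LSG2 (p : Params) (x y : ℤ → ℤ → ℂ) : Prop :=
  ∀ l m,
    p.rho l m / p.sigma l m * (x l (m + 1) / x l m)
        + p.lam1 l * p.mu1 m * x (l + 1) (m + 1) * y l (m + 1)
      = p.sigma l m / p.rho l m * (x (l + 1) (m + 1) / x (l + 1) m)
        + p.lam2 l * p.mu2 m / (x l m * y (l + 1) m) ∧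
    p.sigma l m / p.rho l m * (y (l + 1) (m + 1) / y l (m + 1))
        + p.lam2 l * p.mu2 m / (x l (m + 1) * y l m)
      = p.rho l m / p.sigma l m * (y (l + 1) m / y l m)
        + p.lam1 l * p.mu1 m * x (l + 1) m * y (l + 1) (m + 1)

/-- The pair of lattice equations LMKdV₂. -/
def LMKdV2 (p : Params) (x y : ℤ → ℤ → ℂ) : Prop :=
  ∀ l m,
    p.lam1 l / p.sigma l m * (x (l + 1) (m + 1) / x l (m + 1))
        + p.mu2 m / p.rho l m * (y l m / y l (m + 1))
      = p.lam2 l * p.sigma l m * (y l m / y (l + 1) m)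
        + p.rho l m * p.mu1 m * (x (l + 1) (m + 1) / x (l + 1) m) ∧
    p.rho l m * p.mu1 m * x l (m + 1) * y (l + 1) (m + 1)
        + p.lam2 l * p.sigma l m * x l m * y l (m + 1)
      = p.mu2 m / p.rho l m * x l m * y (l + 1) m
        + p.lam1 l / p.sigma l m * x (l + 1) m * y (l + 1) (m + 1)

/-- The lattice terms of the Lax pair of LSG₂. -/
def lsg2Terms (p : Params) (x y : ℤ → ℤ → ℂ) : ℤ → ℤ → Slot → ℂ := fun l m =>
  Sum.elim
    (fun q => !![1 / p.rho l m, p.lam1 l * x (l + 1) m;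
      p.lam2 l / x l m, p.rho l m * y (l + 1) m / y l m] q.1 q.2)
    (fun q => !![x l (m + 1) / (p.sigma l m * x l m), p.mu2 m / y l m;
      p.mu1 m * y l (m + 1), p.sigma l m] q.1 q.2)

/-- The lattice terms of the Lax pair of LMKdV₂. -/
def lmkdv2Terms (p : Params) (x y : ℤ → ℤ → ℂ) : ℤ → ℤ → Slot → ℂ := fun l m =>
  Sum.elim
    (fun q => !![p.lam1 l * x (l + 1) m / x l m, p.rho l m / y l m;
      y (l + 1) m / p.rho l m, p.lam2 l] q.1 q.2)
    (fun q => !![p.mu1 m * x l (m + 1) / x l m, 1 / (p.sigma l m * y l m);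
      p.sigma l m * y l (m + 1), p.mu2 m] q.1 q.2)

/-- The system with spectral factors `s` is reduced to the pair of lattice equations `Eqn` for
`(x, y)`: up to constant factors absorbed into the lattice terms and a gauge transformation, its
solutions are exactly the lattice terms `terms p x y` with nowhere zero `x, y` solving `Eqn`. -/
def ReducibleTo {F : Type*} [Field F] [Algebra ℂ F] (s : Slot → F)
    (Eqn : Params → (ℤ → ℤ → ℂ) → (ℤ → ℤ → ℂ) → Prop)
    (terms : Params → (ℤ → ℤ → ℂ) → (ℤ → ℤ → ℂ) → ℤ → ℤ → Slot → ℂ) : Prop :=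
  ∃ κ : Slot → ℂ, (∀ k, κ k ≠ 0) ∧ ∀ u : ℤ → ℤ → Slot → ℂ,
    IsSolution s u ↔
      ∃ (p : Params) (x y : ℤ → ℤ → ℂ) (g : ℤ → ℤ → Fin 2 → ℂ),
        (∀ l m, x l m ≠ 0) ∧ (∀ l m, y l m ≠ 0) ∧ (∀ l m i, g l m i ≠ 0) ∧ Eqn p x y ∧
        ∀ l m k, u l m k = κ k * gauge g (terms p x y) l m k

end LaxClass

end

/-!
Write the entries of `L` as `aA, bB, cC, dD` and those of `M` as `αΛ, βΞ, γΓ, δΔ`, a hat for the shift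
of `m` and a bar for the shift of `l`. For fixed unshifted terms the compatibility condition is
linear in the shifted ones and splits into the rows of `L̂`, `M̄`: the entries `(1,1)` and `(1,2)`
constrain only `â, b̂, ᾱ, β̄`, the other two only `ĉ, d̂, γ̄, δ̄`.

With more than six equations, one row has at least four equations for four unknowns. Either they
force some unknown to vanish, or their determinant is a polynomial in the unshifted terms that is
nonzero, as it is nonzero at a suitable `0`-`1` vector (`RowCompatible.exists_polynomial`). So the
system is overdetermined.

With at most six equations, `BΓ` and `CΞ` are proportional, and then the products `AΞ, BΔ, BΛ, DΞ` in
`(1,2)` and `DΓ, CΛ, CΔ, AΓ` in `(2,1)` agree up to a common factor. As `ℂ` is algebraically closed, a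
nonconstant `A / D` satisfies no quadratic equation over `ℂ`, and only three arrangements remain
(`proportional_of_finrank_le_six`). In the first, both products in every entry of `L̂ M`, and of
`M̄ L`, are proportional; there are solutions with `L̂ M = 0 = M̄ L` in which three lattice terms are
arbitrary. The second and third are the systems of LSG₂ and LMKdV₂. Four of their equations are
multiplicatively linear; they provide potentials on `ℤ²`, and the gauge is then fixed by solving
first order recursions, which puts every solution into the required form. What remains of the
other two equations is LSG₂ or LMKdV₂ itself. The case of a trivial system is contained in the
other ones.
-/

namespace LaxClass

/-! ### Linear algebra -/

open MvPolynomial in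
/-- Elimination from a homogeneous linear system whose columns `w (k j) • e j + w (k' j) • e' j`
depend linearly on the parameters `w`: if the system has only the zero solution at one parameter
value `w₀`, then a nonzero polynomial in `w` vanishes wherever it has a nonzero solution. The
polynomial is the determinant of the system composed with a left inverse at `w₀`. -/
theorem exists_polynomial_of_injective {σ ι U : Type*} [Fintype ι] [DecidableEq ι]
    [AddCommGroup U] [Module ℂ U] (k k' : ι → σ) (e e' : ι → U) (w₀ : σ → ℂ)
    (h : ∀ x : ι → ℂ, ∑ j, x j • (w₀ (k j) • e j + w₀ (k' j) • e' j) = 0 → x = 0) :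
    ∃ P : MvPolynomial σ ℂ, P ≠ 0 ∧ ∀ (w : σ → ℂ) (x : ι → ℂ), x ≠ 0 →
      ∑ j, x j • (w (k j) • e j + w (k' j) • e' j) = 0 → eval w P = 0 := by
  have hinj : LinearMap.ker
      (Fintype.linearCombination ℂ fun j => w₀ (k j) • e j + w₀ (k' j) • e' j) = ⊥ := by
    refine LinearMap.ker_eq_bot'.2 fun x hx => h x ?_
    simpa [Fintype.linearCombination_apply] using hx
  obtain ⟨G, hG⟩ := LinearMap.exists_leftInverse_of_injective _ hinj
  have hev (w : σ → ℂ) :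
      eval w (Matrix.of fun i j => X (k j) * C (G (e j) i) + X (k' j) * C (G (e' j) i)).det =
        (Matrix.of fun i j => G (w (k j) • e j + w (k' j) • e' j) i).det := by
    rw [RingHom.map_det]
    congr 1
    ext i j
    simp
  refine ⟨(Matrix.of fun i j => X (k j) * C (G (e j) i) + X (k' j) * C (G (e' j) i)).det,
    fun h0 => ?_, fun w x hx0 hx => ?_⟩
  · have h1 := hev w₀
    have h2 : (Matrix.of fun i j => G (w₀ (k j) • e j + w₀ (k' j) • e' j) i) = 1 := by
      ext i j
      have := congrFun (LinearMap.congr_fun hG (Pi.single j 1)) i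
      simpa [Fintype.linearCombination_apply_single, Matrix.one_apply, Pi.single_apply] using this
    rw [h0, h2] at h1
    simp at h1
  · rw [hev]
    refine Matrix.exists_mulVec_eq_zero_iff.1 ⟨x, hx0, ?_⟩
    ext i
    have := congrFun (congrArg G hx) i
    simpa [Matrix.mulVec, dotProduct, mul_comm, mul_add] using this

/-- `g` is a constant multiple of `f`; symmetric for nonzero vectors. -/
def Proportional {V : Type*} [AddCommGroup V] [Module ℂ V] (f g : V) : Prop :=
  ∃ k : ℂ, g = k • f

section LinearAlgebra

variable {V : Type*} [AddCommGroup V] [Module ℂ V] {f g h : V}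

theorem Proportional.refl (f : V) : Proportional f f := ⟨1, by simp⟩

theorem Proportional.symm (hfg : Proportional f g) (hg : g ≠ 0) : Proportional g f := by
  obtain ⟨k, rfl⟩ := hfg
  have hk : k ≠ 0 := by rintro rfl; simp at hg
  exact ⟨k⁻¹, by simp [smul_smul, hk]⟩

theorem Proportional.trans (hfg : Proportional f g) (hgh : Proportional g h) :
    Proportional f h := by
  obtain ⟨k, rfl⟩ := hfg
  obtain ⟨l, rfl⟩ := hgh
  exact ⟨l * k, by simp [smul_smul]⟩

theorem eq_zero_of_not_proportional (hf : f ≠ 0) (hfg : ¬ Proportional f g) {x y : ℂ}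
    (hxy : x • f + y • g = 0) : x = 0 ∧ y = 0 := by
  have hy : y = 0 := by
    by_contra hy
    refine hfg ⟨-(y⁻¹ * x), ?_⟩
    rw [neg_smul, mul_smul, eq_neg_of_add_eq_zero_left hxy, smul_neg, smul_smul,
      inv_mul_cancel₀ hy, one_smul, neg_neg]
  subst hy
  simpa [hf] using hxy

theorem finrank_span_le_one {S : Set V} (hS : ∀ g ∈ S, Proportional f g) :
    Module.finrank ℂ (Submodule.span ℂ S) ≤ 1 := by
  have hle : Submodule.span ℂ S ≤ Submodule.span ℂ {f} := by
    refine Submodule.span_le.2 fun g hg => ?_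
    obtain ⟨k, rfl⟩ := hS g hg
    exact Submodule.smul_mem _ _ (Submodule.mem_span_singleton_self f)
  refine (Submodule.finrank_mono hle).trans ?_
  simpa using finrank_span_le_card (R := ℂ) ({f} : Set V)

theorem proportional_of_finrank_span_le_one {S : Set V} (hS : S.Finite)
    (h1 : Module.finrank ℂ (Submodule.span ℂ S) ≤ 1) (hf : f ∈ S) (hg : g ∈ S) (hf0 : f ≠ 0) :
    Proportional f g := by
  have := FiniteDimensional.span_of_finite ℂ hS
  obtain ⟨v, hv⟩ := finrank_le_one_iff.1 h1
  obtain ⟨x, hx⟩ := hv ⟨f, Submodule.subset_span hf⟩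
  obtain ⟨y, hy⟩ := hv ⟨g, Submodule.subset_span hg⟩
  refine (Proportional.symm ⟨x, ?_⟩ hf0).trans (g := (v : V)) ⟨y, ?_⟩
  · simpa using (congrArg Subtype.val hx).symm
  · simpa using (congrArg Subtype.val hy).symm

theorem one_le_finrank_span {S : Set V} (hS : S.Finite) (hf : f ∈ S) (hf0 : f ≠ 0) :
    1 ≤ Module.finrank ℂ (Submodule.span ℂ S) := by
  have := FiniteDimensional.span_of_finite ℂ hS
  have : Nontrivial (Submodule.span ℂ S) :=
    ⟨⟨⟨f, Submodule.subset_span hf⟩, 0, fun h => hf0 (congrArg Subtype.val h)⟩⟩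
  exact Module.finrank_pos

/-- If the family `v` spans a space of dimension at least its size minus one, it has at most one
linear relation up to scaling, which is excluded by requiring a suitable coefficient to vanish. -/
theorem exists_coordinate_of_finrank {ι : Type*} [Fintype ι] [Nonempty ι] (v : ι → V)
    (h : Fintype.card ι ≤ Module.finrank ℂ (Submodule.span ℂ (Set.range v)) + 1) :
    ∃ j, ∀ x : ι → ℂ, ∑ i, x i • v i = 0 → x j = 0 → x = 0 := by
  have hrk := LinearMap.finrank_range_add_finrank_ker (Fintype.linearCombination ℂ v)
  rw [Fintype.range_linearCombination, Module.finrank_fintype_fun_eq_card] at hrk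
  obtain ⟨k, hk⟩ := finrank_le_one_iff.1
    (show Module.finrank ℂ (LinearMap.ker (Fintype.linearCombination ℂ v)) ≤ 1 by omega)
  have hmul (x : ι → ℂ) (hx : ∑ i, x i • v i = 0) : ∃ t : ℂ, t • (k : ι → ℂ) = x := by
    obtain ⟨t, ht⟩ := hk ⟨x, by simpa [Fintype.linearCombination_apply] using hx⟩
    exact ⟨t, congrArg Subtype.val ht⟩
  by_cases h0 : (k : ι → ℂ) = 0
  · obtain ⟨j⟩ := ‹Nonempty ι›
    refine ⟨j, fun x hx _ => ?_⟩
    obtain ⟨t, rfl⟩ := hmul x hx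
    simp [h0]
  · obtain ⟨j, hj⟩ := Function.ne_iff.1 h0
    refine ⟨j, fun x hx hxj => ?_⟩
    obtain ⟨t, rfl⟩ := hmul x hx
    have ht : t = 0 := (mul_eq_zero.1 hxj).resolve_right hj
    simp [ht]

end LinearAlgebra

/-! ### Elimination on an elementary square -/

section Row

variable {V : Type*} [AddCommGroup V] [Module ℂ V]

open MvPolynomial

/-- The row `(â, b̂)` of `L̂` and the row `(ᾱ, β̄)` of `M̄` satisfy the first row of the compatibility
condition, whose spectral products are `p, q, r` in the first and `X, W, Z, Y` in the second entry;
`w` are the unshifted lattice terms. -/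
def RowCompatible (p q r X W Z Y : V) (w : Slot → ℂ) (a' b' α' β' : ℂ) : Prop :=
  (a' * w (.inr (0, 0)) - α' * w (.inl (0, 0))) • p + (b' * w (.inr (1, 0))) • q
      - (β' * w (.inl (1, 0))) • r = 0 ∧
  (a' * w (.inr (0, 1))) • X + (b' * w (.inr (1, 1))) • W
      - (α' * w (.inl (0, 1))) • Z - (β' * w (.inl (1, 1))) • Y = 0

/-- The values `w₀` may vanish: they only serve to show that a determinant is a nonzero polynomial.
The unknowns `x₂`, `x₃` stand for `-ᾱ`, `-β̄`. -/
theorem RowCompatible.exists_polynomial_of_injective (p q r X W Z Y : V) (w₀ : Slot → ℂ)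
    (h : ∀ x₀ x₁ x₂ x₃ : ℂ,
      (x₀ * w₀ (.inr (0, 0)) + x₂ * w₀ (.inl (0, 0))) • p + (x₁ * w₀ (.inr (1, 0))) • q
        + (x₃ * w₀ (.inl (1, 0))) • r = 0 →
      (x₀ * w₀ (.inr (0, 1))) • X + (x₁ * w₀ (.inr (1, 1))) • W
        + (x₂ * w₀ (.inl (0, 1))) • Z + (x₃ * w₀ (.inl (1, 1))) • Y = 0 →
      x₀ = 0 ∧ x₁ = 0 ∧ x₂ = 0 ∧ x₃ = 0) :
    ∃ P : MvPolynomial Slot ℂ, P ≠ 0 ∧ ∀ (w : Slot → ℂ) (a' b' α' β' : ℂ), a' ≠ 0 →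
      RowCompatible p q r X W Z Y w a' b' α' β' → eval w P = 0 := by
  obtain ⟨P, hP, hP'⟩ := LaxClass.exists_polynomial_of_injective
    (ι := Fin 4) (U := V × V)
    ![(.inr (0, 0) : Slot), .inr (1, 0), .inl (0, 0), .inl (1, 0)]
    ![(.inr (0, 1) : Slot), .inr (1, 1), .inl (0, 1), .inl (1, 1)]
    ![(p, 0), (q, 0), (p, 0), (r, 0)] ![(0, X), (0, W), (0, Z), (0, Y)] w₀ (by
      intro x hx
      simp only [Fin.sum_univ_four, Prod.ext_iff] at hx
      obtain ⟨h1, h2⟩ := hx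
      obtain ⟨h₀, h₁, h₂, h₃⟩ := h (x 0) (x 1) (x 2) (x 3)
        (by simp at h1; simp only [mul_smul, add_smul]; rw [← h1]; abel)
        (by simp at h2; simp only [mul_smul]; rw [← h2])
      ext i
      fin_cases i <;> assumption)
  refine ⟨P, hP, fun w a' b' α' β' ha hw => hP' w ![a', b', -α', -β'] ?_ ?_⟩
  · intro h0
    exact ha (congrFun h0 0)
  · obtain ⟨h1, h2⟩ := hw
    simp only [Fin.sum_univ_four, Prod.ext_iff]
    constructor
    · simp only [mul_smul, sub_smul] at h1
      simp
      rw [← h1]; abel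
    · simp only [mul_smul] at h2
      simp
      rw [← h2]; abel

/-- If the two entries of a row give at least four equations, the four shifted terms occurring in
them can be eliminated. Either some nonzero term is forced to vanish, or the determinant of the
system is nonzero at a suitable `0`-`1` vector. -/
theorem RowCompatible.exists_polynomial {p q r X W Z Y : V} (hp : p ≠ 0) (hq : q ≠ 0) (hr : r ≠ 0)
    (hX : X ≠ 0) (hW : W ≠ 0) (hZ : Z ≠ 0) (hY : Y ≠ 0)
    (h : 4 ≤ Module.finrank ℂ (Submodule.span ℂ {p, q, r}) +
      Module.finrank ℂ (Submodule.span ℂ {X, W, Z, Y})) :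
    ∃ P : MvPolynomial Slot ℂ, P ≠ 0 ∧ ∀ (w : Slot → ℂ) (a' b' α' β' : ℂ), (∀ k, w k ≠ 0) →
      a' ≠ 0 → b' ≠ 0 → β' ≠ 0 →
      RowCompatible p q r X W Z Y w a' b' α' β' → eval w P = 0 := by
  suffices H : (∀ (w : Slot → ℂ) (a' b' α' β' : ℂ), (∀ k, w k ≠ 0) → a' ≠ 0 → b' ≠ 0 → β' ≠ 0 →
      ¬ RowCompatible p q r X W Z Y w a' b' α' β') ∨ ∃ w₀ : Slot → ℂ, ∀ x₀ x₁ x₂ x₃ : ℂ,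
      (x₀ * w₀ (.inr (0, 0)) + x₂ * w₀ (.inl (0, 0))) • p + (x₁ * w₀ (.inr (1, 0))) • q
        + (x₃ * w₀ (.inl (1, 0))) • r = 0 →
      (x₀ * w₀ (.inr (0, 1))) • X + (x₁ * w₀ (.inr (1, 1))) • W
        + (x₂ * w₀ (.inl (0, 1))) • Z + (x₃ * w₀ (.inl (1, 1))) • Y = 0 →
      x₀ = 0 ∧ x₁ = 0 ∧ x₂ = 0 ∧ x₃ = 0 by
    rcases H with H | ⟨w₀, hw₀⟩
    · exact ⟨1, one_ne_zero, fun w a' b' α' β' hw ha hb hβ hc =>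
        (H w a' b' α' β' hw ha hb hβ hc).elim⟩
    · obtain ⟨P, hP, hP'⟩ := exists_polynomial_of_injective p q r X W Z Y w₀ hw₀
      exact ⟨P, hP, fun w a' b' α' β' _ ha _ _ => hP' w a' b' α' β' ha⟩
  by_cases hpq : Proportional p q
  · by_cases hpr : Proportional p r
    · -- The three products of the first entry agree, so the second entry has three dimensions.
      right
      have h1 : Module.finrank ℂ (Submodule.span ℂ {p, q, r}) ≤ 1 :=
        finrank_span_le_one (f := p) (by simp [hpq, hpr, Proportional.refl])
      obtain ⟨j, hj⟩ := exists_coordinate_of_finrank ![X, W, Z, Y] (by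
        have : Set.range ![X, W, Z, Y] = {X, W, Z, Y} := by
          ext; simp [eq_comm]; tauto
        rw [this, Fintype.card_fin]; omega)
      have hj' (x₀ x₁ x₂ x₃ : ℂ) (hx : x₀ • X + x₁ • W + x₂ • Z + x₃ • Y = 0)
          (hxj : (![x₀, x₁, x₂, x₃] : Fin 4 → ℂ) j = 0) : x₀ = 0 ∧ x₁ = 0 ∧ x₂ = 0 ∧ x₃ = 0 := by
        have := hj ![x₀, x₁, x₂, x₃] (by simpa [Fin.sum_univ_four] using hx) hxj
        exact ⟨congrFun this 0, congrFun this 1, congrFun this 2, congrFun this 3⟩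
      refine ⟨Sum.elim
        (fun i => !![if j = 2 then 1 else 0, 1; if j = 3 then 1 else 0, 1] i.1 i.2)
        (fun i => !![if j = 0 then 1 else 0, 1; if j = 1 then 1 else 0, 1] i.1 i.2),
        fun x₀ x₁ x₂ x₃ h1 h2 => hj' _ _ _ _ (by simpa using h2) ?_⟩
      fin_cases j <;> simpa [hp, hq, hr] using h1
    · left
      rintro w a' b' α' β' hw ha hb hβ ⟨h1, -⟩
      obtain ⟨k, rfl⟩ := hpq
      have := eq_zero_of_not_proportional hp hpr
        (x := a' * w (.inr (0, 0)) - α' * w (.inl (0, 0)) + b' * w (.inr (1, 0)) * k)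
        (y := -(β' * w (.inl (1, 0)))) (by rw [← h1]; module)
      simpa [hβ, hw] using this.2
  by_cases hpr : Proportional p r
  · left
    rintro w a' b' α' β' hw ha hb hβ ⟨h1, -⟩
    obtain ⟨k, rfl⟩ := hpr
    have := eq_zero_of_not_proportional hp hpq
      (x := a' * w (.inr (0, 0)) - α' * w (.inl (0, 0)) - β' * w (.inl (1, 0)) * k)
      (y := b' * w (.inr (1, 0))) (by rw [← h1]; module)
    simpa [hb, hw] using this.2
  -- Now `p, q` and `p, r` are independent pairs. If some two cyclically adjacent of `X, W, Z, Y` are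
  -- independent as well, setting four of the eight terms to zero leaves one pair in each entry.
  by_cases hZY : Proportional Z Y
  on_goal 2 =>
    right
    refine ⟨Sum.elim (fun i => !![0, 1; 0, 1] i.1 i.2) (fun i => !![1, 0; 1, 0] i.1 i.2),
      fun x₀ x₁ x₂ x₃ h1 h2 => ?_⟩
    have h1 := eq_zero_of_not_proportional hp hpq (x := x₀) (y := x₁) (by simpa using h1)
    have h2 := eq_zero_of_not_proportional hZ hZY (x := x₂) (y := x₃) (by simpa using h2)
    exact ⟨h1.1, h1.2, h2⟩
  by_cases hXY : Proportional X Y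
  on_goal 2 =>
    right
    refine ⟨Sum.elim (fun i => !![1, 0; 0, 1] i.1 i.2) (fun i => !![0, 1; 1, 0] i.1 i.2),
      fun x₀ x₁ x₂ x₃ h1 h2 => ?_⟩
    have h1 := eq_zero_of_not_proportional hp hpq (x := x₂) (y := x₁) (by simpa using h1)
    have h2 := eq_zero_of_not_proportional hX hXY (x := x₀) (y := x₃) (by simpa using h2)
    exact ⟨h2.1, h1.2, h1.1, h2.2⟩
  by_cases hWZ : Proportional W Z
  on_goal 2 =>
    right
    refine ⟨Sum.elim (fun i => !![0, 1; 1, 0] i.1 i.2) (fun i => !![1, 0; 0, 1] i.1 i.2),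
      fun x₀ x₁ x₂ x₃ h1 h2 => ?_⟩
    have h1 := eq_zero_of_not_proportional hp hpr (x := x₀) (y := x₃) (by simpa using h1)
    have h2 := eq_zero_of_not_proportional hW hWZ (x := x₁) (y := x₂) (by simpa using h2)
    exact ⟨h1.1, h2.1, h2.2, h1.2⟩
  -- The products of the second entry are all proportional, so those of the first are independent.
  left
  have hle : Module.finrank ℂ (Submodule.span ℂ {X, W, Z, Y}) ≤ 1 := by
    have hXZ := hXY.trans (hZY.symm hY)
    refine finrank_span_le_one (f := X) ?_
    simp [Proportional.refl, hXY, hXZ, hXZ.trans (hWZ.symm hZ)]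
  have hli : LinearIndependent ℂ ![p, q, r] := by
    rw [linearIndependent_iff_card_le_finrank_span, Set.finrank]
    have : Set.range ![p, q, r] = {p, q, r} := by
      ext; simp [eq_comm]; tauto
    rw [this, Fintype.card_fin]; omega
  rintro w a' b' α' β' hw ha hb hβ ⟨h1, -⟩
  have := Fintype.linearIndependent_iff.1 hli
    ![a' * w (.inr (0, 0)) - α' * w (.inl (0, 0)), b' * w (.inr (1, 0)), -(β' * w (.inl (1, 0)))]
    (by rw [← h1]; simp [Fin.sum_univ_three]; module) 1
  simp [hb, hw] at this

end Row

/-! ### Counting the equations -/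

variable {F : Type*} [Field F] [Algebra ℂ F]

/-- Exchange of the two matrix indices. -/
def swapIndices : Slot → Slot :=
  Sum.map (Prod.map Fin.rev Fin.rev) (Prod.map Fin.rev Fin.rev)

theorem swapIndices_injective : Function.Injective swapIndices :=
  Sum.map_injective.2 ⟨Fin.rev_injective.prodMap Fin.rev_injective,
    Fin.rev_injective.prodMap Fin.rev_injective⟩

/-- The compatibility condition splits into one condition for each row of `L̂` and `M̄`; the second
becomes the first under the exchange of the two indices. -/
theorem quadCompatible_iff (s : Slot → F) (v vHat vBar : Slot → ℂ) :
    QuadCompatible s v vHat vBar ↔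
      RowCompatible (s (.inl (0, 0)) * s (.inr (0, 0))) (s (.inl (0, 1)) * s (.inr (1, 0)))
        (s (.inl (1, 0)) * s (.inr (0, 1))) (s (.inl (0, 0)) * s (.inr (0, 1)))
        (s (.inl (0, 1)) * s (.inr (1, 1))) (s (.inl (0, 1)) * s (.inr (0, 0)))
        (s (.inl (1, 1)) * s (.inr (0, 1))) v
        (vHat (.inl (0, 0))) (vHat (.inl (0, 1))) (vBar (.inr (0, 0))) (vBar (.inr (0, 1))) ∧
      RowCompatible (s (.inl (1, 1)) * s (.inr (1, 1))) (s (.inl (1, 0)) * s (.inr (0, 1)))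
        (s (.inl (0, 1)) * s (.inr (1, 0))) (s (.inl (1, 1)) * s (.inr (1, 0)))
        (s (.inl (1, 0)) * s (.inr (0, 0))) (s (.inl (1, 0)) * s (.inr (1, 1)))
        (s (.inl (0, 0)) * s (.inr (1, 0))) (v ∘ swapIndices)
        (vHat (.inl (1, 1))) (vHat (.inl (1, 0))) (vBar (.inr (1, 1))) (vBar (.inr (1, 0))) := by
  have h0 : Fin.rev (0 : Fin 2) = 1 := rfl
  have h1 : Fin.rev (1 : Fin 2) = 0 := rfl
  rw [QuadCompatible, ← Matrix.ext_iff]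
  simp only [Fin.forall_fin_two, Matrix.mul_apply, Fin.sum_univ_two, matL, matM, separable,
    Matrix.of_apply, RowCompatible, Algebra.smul_def, map_sub, map_mul, Function.comp,
    swapIndices, Sum.map_inl, Sum.map_inr, Prod.map_apply, h0, h1]
  constructor
  · rintro ⟨⟨h1, h2⟩, h3, h4⟩
    refine ⟨⟨?_, ?_⟩, ?_, ?_⟩
    · linear_combination h1
    · linear_combination h2
    · linear_combination h4
    · linear_combination h3
  · rintro ⟨⟨h1, h2⟩, h4, h3⟩
    refine ⟨⟨?_, ?_⟩, ?_, ?_⟩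
    · linear_combination h1
    · linear_combination h2
    · linear_combination h3
    · linear_combination h4

/-- The count of equations, grouped by the rows and by the spectral products in the order of
`quadCompatible_iff`. -/
theorem numEquations_eq (s : Slot → F) :
    numEquations s =
      (Module.finrank ℂ (Submodule.span ℂ {s (.inl (0, 0)) * s (.inr (0, 0)),
          s (.inl (0, 1)) * s (.inr (1, 0)), s (.inl (1, 0)) * s (.inr (0, 1))}) +
        Module.finrank ℂ (Submodule.span ℂ {s (.inl (0, 0)) * s (.inr (0, 1)),
          s (.inl (0, 1)) * s (.inr (1, 1)), s (.inl (0, 1)) * s (.inr (0, 0)),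
          s (.inl (1, 1)) * s (.inr (0, 1))})) +
      (Module.finrank ℂ (Submodule.span ℂ {s (.inl (1, 1)) * s (.inr (1, 1)),
          s (.inl (1, 0)) * s (.inr (0, 1)), s (.inl (0, 1)) * s (.inr (1, 0))}) +
        Module.finrank ℂ (Submodule.span ℂ {s (.inl (1, 1)) * s (.inr (1, 0)),
          s (.inl (1, 0)) * s (.inr (0, 0)), s (.inl (1, 0)) * s (.inr (1, 1)),
          s (.inl (0, 0)) * s (.inr (1, 0))})) := by
  have key (f g : Fin 2 → F) (S : Set F) (hS : {f 0, f 1, g 0, g 1} = S) :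
      Module.finrank ℂ (Submodule.span ℂ (Set.range f ∪ Set.range g)) =
        Module.finrank ℂ (Submodule.span ℂ S) := by
    have hfg : Set.range f ∪ Set.range g = {f 0, f 1, g 0, g 1} := by
      ext
      simp [Fin.exists_fin_two, eq_comm, or_assoc]
    rw [← hS, hfg]
  rw [numEquations, Fin.sum_univ_two, Fin.sum_univ_two, Fin.sum_univ_two,
    add_comm (Module.finrank ℂ (Submodule.span ℂ {s (.inl (1, 1)) * s (.inr (1, 1)),
      s (.inl (1, 0)) * s (.inr (0, 1)), s (.inl (0, 1)) * s (.inr (1, 0))}))]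
  congr 2 <;> refine key _ _ _ ?_ <;> ext x <;>
    simp only [matL, matM, Matrix.of_apply, Set.mem_insert_iff, Set.mem_singleton_iff, mul_comm] <;>
    tauto

/-- With more than six equations, one of the two rows has at least four. -/
theorem overdetermined_of_lt_numEquations {s : Slot → F} (hs : ∀ k, s k ≠ 0)
    (h : 6 < numEquations s) : Overdetermined s := by
  refine ⟨h, ?_⟩
  rw [numEquations_eq] at h
  have hs2 (k l : Slot) : s k * s l ≠ 0 := mul_ne_zero (hs k) (hs l)
  rcases (by omega : ∀ a b : ℕ, 6 < a + b → 4 ≤ a ∨ 4 ≤ b) _ _ h with h | h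
  · obtain ⟨P, hP, hP'⟩ := RowCompatible.exists_polynomial (hs2 _ _) (hs2 _ _) (hs2 _ _) (hs2 _ _)
      (hs2 _ _) (hs2 _ _) (hs2 _ _) h
    exact ⟨P, hP, fun v vHat vBar hv hvh hvb hq => hP' v _ _ _ _ hv (hvh _) (hvh _) (hvb _)
      ((quadCompatible_iff s v vHat vBar).1 hq).1⟩
  · obtain ⟨P, hP, hP'⟩ := RowCompatible.exists_polynomial (hs2 _ _) (hs2 _ _) (hs2 _ _) (hs2 _ _)
      (hs2 _ _) (hs2 _ _) (hs2 _ _) h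
    refine ⟨MvPolynomial.rename
      swapIndices P, ?_,
      fun v vHat vBar hv hvh hvb hq => ?_⟩
    · rwa [Ne, map_eq_zero_iff _ (MvPolynomial.rename_injective _ swapIndices_injective)]
    · rw [MvPolynomial.eval_rename]
      exact hP' _ _ _ _ _ (fun k => hv _) (hvh _) (hvh _) (hvb _)
        ((quadCompatible_iff s v vHat vBar).1 hq).2

/-! ### Constant factors -/

/-- Constant factors can be moved from the spectral to the lattice terms. -/
theorem isSolution_smul {s : Slot → F} {κ : Slot → ℂ} (hκ : ∀ k, κ k ≠ 0)
    (u : ℤ → ℤ → Slot → ℂ) :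
    IsSolution s (fun l m k => κ k * u l m k) ↔ IsSolution (fun k => κ k • s k) u := by
  have h (v : Slot → ℂ) : separable s (fun k => κ k * v k) = separable (fun k => κ k • s k) v := by
    ext k
    simp only [separable, map_mul, Algebra.smul_def]
    ring
  simp [IsSolution, QuadCompatible, h, hκ]

theorem Underdetermined.of_smul {s : Slot → F} {κ : Slot → ℂ} (hκ : ∀ k, κ k ≠ 0)
    (h : Underdetermined fun k => κ k • s k) : Underdetermined s := by
  obtain ⟨T, hT, h⟩ := h
  refine ⟨T, hT, fun f hf => ?_⟩
  obtain ⟨u, hu, huf⟩ := h (fun l m k => f l m k / κ k) fun l m k => div_ne_zero (hf l m k) (hκ k)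
  refine ⟨_, (isSolution_smul hκ u).2 hu, fun l m k hk => ?_⟩
  simp only [huf l m k hk]
  exact mul_div_cancel₀ _ (hκ k)

theorem ReducibleTo.of_smul {s : Slot → F} {κ : Slot → ℂ} (hκ : ∀ k, κ k ≠ 0)
    {Eqn : Params → (ℤ → ℤ → ℂ) → (ℤ → ℤ → ℂ) → Prop}
    {terms : Params → (ℤ → ℤ → ℂ) → (ℤ → ℤ → ℂ) → ℤ → ℤ → Slot → ℂ}
    (h : ∀ u, IsSolution (fun k => κ k • s k) u ↔
      ∃ (p : Params) (x y : ℤ → ℤ → ℂ) (g : ℤ → ℤ → Fin 2 → ℂ),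
        (∀ l m, x l m ≠ 0) ∧ (∀ l m, y l m ≠ 0) ∧ (∀ l m i, g l m i ≠ 0) ∧ Eqn p x y ∧
        ∀ l m k, u l m k = gauge g (terms p x y) l m k) :
    ReducibleTo s Eqn terms := by
  refine ⟨κ, hκ, fun u => ?_⟩
  obtain ⟨v, rfl⟩ : ∃ v : ℤ → ℤ → Slot → ℂ, u = fun l m k => κ k * v l m k :=
    ⟨fun l m k => u l m k / κ k, by ext l m k; exact (mul_div_cancel₀ _ (hκ k)).symm⟩
  rw [isSolution_smul hκ, h]
  simp [hκ]

theorem Proportional.exists_smul_eq {f g : F} (h : Proportional f g) (hg : g ≠ 0) :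
    ∃ k : ℂ, k ≠ 0 ∧ k • g = f := by
  obtain ⟨k, hk⟩ := h.symm hg
  refine ⟨k, ?_, hk.symm⟩
  rintro rfl
  obtain ⟨l, rfl⟩ := h
  simp [show f = 0 by simpa using hk] at hg

/-! ### Underdetermined systems -/

/-- The 8-tuple of the entries of two matrices, first the rows of `L`, then those of `M`. -/
def slots (a b c d α β γ δ : ℂ) : Slot → ℂ :=
  Sum.elim (fun q => !![a, b; c, d] q.1 q.2) (fun q => !![α, β; γ, δ] q.1 q.2)

/-- If the two spectral products in each entry of `L̂ M`, and those in each entry of `M̄ L`, agree,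
the system is solved by rank one matrices with `L̂ M = 0 = M̄ L`, in which `a`, `b`, `α` are
arbitrary. -/
theorem underdetermined_of_eq {s : Slot → F}
    (h1 : s (.inl (0, 1)) * s (.inr (1, 0)) = s (.inl (0, 0)) * s (.inr (0, 0)))
    (h2 : s (.inl (1, 0)) * s (.inr (0, 1)) = s (.inl (0, 0)) * s (.inr (0, 0)))
    (h3 : s (.inl (0, 1)) * s (.inr (1, 1)) = s (.inl (0, 0)) * s (.inr (0, 1)))
    (h4 : s (.inl (1, 1)) * s (.inr (0, 1)) = s (.inl (0, 1)) * s (.inr (0, 0)))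
    (hs : ∀ k, s k ≠ 0) : Underdetermined s := by
  have h5 : s (.inl (1, 1)) * s (.inr (1, 0)) = s (.inl (1, 0)) * s (.inr (0, 0)) := by
    refine mul_left_cancel₀ (mul_ne_zero (hs (.inl (0, 1))) (hs (.inr (0, 1)))) ?_
    linear_combination s (.inl (1, 1)) * s (.inr (0, 1)) * h1 -
      s (.inl (0, 1)) * s (.inr (0, 0)) * h2 + s (.inl (0, 0)) * s (.inr (0, 0)) * h4
  have h6 : s (.inl (1, 0)) * s (.inr (1, 1)) = s (.inl (0, 0)) * s (.inr (1, 0)) := by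
    refine mul_left_cancel₀ (mul_ne_zero (hs (.inl (0, 1))) (hs (.inr (0, 1)))) ?_
    linear_combination s (.inl (1, 0)) * s (.inr (0, 1)) * h3 +
      s (.inl (0, 0)) * s (.inr (0, 1)) * h2 - s (.inl (0, 0)) * s (.inr (0, 1)) * h1
  have h7 : s (.inl (1, 1)) * s (.inr (1, 1)) = s (.inl (0, 0)) * s (.inr (0, 0)) := by
    refine mul_left_cancel₀ (mul_ne_zero (hs (.inl (0, 1))) (hs (.inr (0, 1)))) ?_
    linear_combination s (.inl (1, 1)) * s (.inr (0, 1)) * h3 +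
      s (.inl (0, 0)) * s (.inr (0, 1)) * h4
  refine ⟨{.inl (0, 0), .inl (0, 1), .inr (0, 0)}, by decide, fun f hf => ?_⟩
  obtain ⟨a, ha⟩ : ∃ a : ℤ → ℤ → ℂ, a = fun l m => f l m (.inl (0, 0)) := ⟨_, rfl⟩
  obtain ⟨b, hb⟩ : ∃ b : ℤ → ℤ → ℂ, b = fun l m => f l m (.inl (0, 1)) := ⟨_, rfl⟩
  obtain ⟨α, hα⟩ : ∃ α : ℤ → ℤ → ℂ, α = fun l m => f l m (.inr (0, 0)) := ⟨_, rfl⟩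
  have ha0 (l m) : a l m ≠ 0 := by simp [ha, hf]
  have hb0 (l m) : b l m ≠ 0 := by simp [hb, hf]
  have hα0 (l m) : α l m ≠ 0 := by simp [hα, hf]
  -- The rows of `L` and of `M` are proportional to `(a, b)`, and the columns of `L(l, m)` and of
  -- `M(l, m)` to `(1, -a/b)` at `(l + 1, m)` and at `(l, m + 1)`, so that `L̂ M = 0 = M̄ L`.
  refine ⟨fun l m => slots (a l m) (b l m) (-a (l + 1) m / b (l + 1) m * a l m)
      (-a (l + 1) m / b (l + 1) m * b l m) (α l m) (α l m * b l m / a l m)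
      (-a l (m + 1) / b l (m + 1) * α l m) (-a l (m + 1) / b l (m + 1) * (α l m * b l m / a l m)),
    ⟨?_, ?_⟩, ?_⟩
  · rintro l m (⟨i, j⟩ | ⟨i, j⟩) <;> fin_cases i <;> fin_cases j <;>
      simp [slots, ha0, hb0, hα0]
  · intro l m
    have e1 := ha0 l m
    have e2 := ha0 (l + 1) m
    have e3 := hb0 l m
    have e4 := hb0 (l + 1) m
    have e5 := ha0 l (m + 1)
    have e6 := hb0 l (m + 1)
    have hz₁ {x y z : ℂ} (P : F) (hx : x + y - z = 0) : x • P + y • P - z • P = 0 := by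
      rw [← add_smul, ← sub_smul, hx, zero_smul]
    have hz₂ {x y z t : ℂ} (P Q : F) (hx : x + y = 0) (hz : z + t = 0) :
        x • P + y • P - z • Q - t • Q = 0 := by
      rw [← add_smul, sub_sub, ← add_smul, hx, hz, zero_smul, zero_smul, sub_zero]
    rw [quadCompatible_iff]
    simp only [RowCompatible, h1, h2, h3, h4, h5, h6, h7]
    refine ⟨⟨hz₁ _ ?_, hz₂ _ _ ?_ ?_⟩, hz₁ _ ?_, hz₂ _ _ ?_ ?_⟩ <;>
      simp [slots, swapIndices] <;> field_simp <;> ring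
  · intro l m k hk
    simp only [Finset.mem_insert, Finset.mem_singleton] at hk
    rcases hk with rfl | rfl | rfl <;> simp [slots, ha, hb, hα]

theorem underdetermined_of_proportional {s : Slot → F} (hs : ∀ k, s k ≠ 0)
    (h1 : Proportional (s (.inl (0, 0)) * s (.inr (0, 0))) (s (.inl (0, 1)) * s (.inr (1, 0))))
    (h2 : Proportional (s (.inl (0, 0)) * s (.inr (0, 0))) (s (.inl (1, 0)) * s (.inr (0, 1))))
    (h3 : Proportional (s (.inl (0, 0)) * s (.inr (0, 1))) (s (.inl (0, 1)) * s (.inr (1, 1))))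
    (h4 : Proportional (s (.inl (0, 1)) * s (.inr (0, 0))) (s (.inl (1, 1)) * s (.inr (0, 1)))) :
    Underdetermined s := by
  have hs2 (k l : Slot) : s k * s l ≠ 0 := mul_ne_zero (hs k) (hs l)
  obtain ⟨k₁, hk₁, h1⟩ := h1.exists_smul_eq (hs2 _ _)
  obtain ⟨k₂, hk₂, h2⟩ := h2.exists_smul_eq (hs2 _ _)
  obtain ⟨k₃, hk₃, h3⟩ := h3.exists_smul_eq (hs2 _ _)
  obtain ⟨k₄, hk₄, h4⟩ := h4.exists_smul_eq (hs2 _ _)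
  have hκ : ∀ k, slots 1 1 k₂ k₄ 1 1 k₁ k₃ k ≠ 0 := by
    rintro (⟨i, j⟩ | ⟨i, j⟩) <;> fin_cases i <;> fin_cases j <;> simp [slots, *]
  refine Underdetermined.of_smul hκ (underdetermined_of_eq ?_ ?_ ?_ ?_ fun k => ?_)
  · simpa [slots] using h1
  · simpa [slots] using h2
  · simpa [slots] using h3
  · simpa [slots] using h4
  · exact smul_ne_zero (hκ k) (hs k)

/-! ### Recursions on the lattice -/

section Recursion

theorem exists_int_recursion {X : Type*} (e : ℤ → X ≃ X) (x₀ : X) :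
    ∃ φ : ℤ → X, φ 0 = x₀ ∧ ∀ l, φ (l + 1) = e l (φ l) := by
  let φ : ℤ → X := fun l => Int.rec (motive := fun _ => X)
    (fun n => Nat.rec x₀ (fun k x => e k x) n)
    (fun n => Nat.rec ((e (-1)).symm x₀) (fun k x => (e (Int.negSucc (k + 1))).symm x) n) l
  refine ⟨φ, rfl, fun l => ?_⟩
  rcases l with n | n
  · rfl
  · cases n with
    | zero => exact ((e (-1)).apply_symm_apply x₀).symm
    | succ k => exact ((e (Int.negSucc (k + 1))).apply_symm_apply _).symm

theorem exists_ratio {f : ℤ → ℂ} (hf : ∀ l, f l ≠ 0) :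
    ∃ φ : ℤ → ℂ, (∀ l, φ l ≠ 0) ∧ φ 0 = 1 ∧ ∀ l, φ (l + 1) = f l * φ l := by
  obtain ⟨φ, h0, h⟩ := exists_int_recursion (fun l => Equiv.mulLeft (Units.mk0 (f l) (hf l))) 1
  exact ⟨fun l => φ l, fun l => (φ l).ne_zero, by simp [h0], fun l => by simp [h]⟩

theorem exists_product {f : ℤ → ℂ} (hf : ∀ l, f l ≠ 0) :
    ∃ φ : ℤ → ℂ, (∀ l, φ l ≠ 0) ∧ ∀ l, φ (l + 1) * φ l = f l := by
  obtain ⟨φ, -, h⟩ := exists_int_recursion (fun l => Equiv.divLeft (Units.mk0 (f l) (hf l))) 1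
  exact ⟨fun l => φ l, fun l => (φ l).ne_zero, fun l => by simp [h]⟩

theorem int_forall_of_iff {P : ℤ → Prop} (h0 : P 0) (h : ∀ m, P m ↔ P (m + 1)) (m : ℤ) : P m := by
  induction m using Int.induction_on with
  | zero => exact h0
  | succ n ih => exact (h _).1 ih
  | pred n ih => exact (h _).2 (by simpa using ih)

/-- A multiplicatively closed pair of lattice functions has a potential. -/
theorem exists_potential {f h : ℤ → ℤ → ℂ} (hf : ∀ l m, f l m ≠ 0) (hh : ∀ l m, h l m ≠ 0)
    (hfh : ∀ l m, f l (m + 1) * h l m = h (l + 1) m * f l m) :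
    ∃ φ : ℤ → ℤ → ℂ, (∀ l m, φ l m ≠ 0) ∧ (∀ l m, φ (l + 1) m = f l m * φ l m) ∧
      ∀ l m, φ l (m + 1) = h l m * φ l m := by
  obtain ⟨φ, hφ, -, hφf⟩ := exists_ratio fun l => hf l 0
  choose ψ hψ hψ0 hψh using fun l => exists_ratio (hh l)
  refine ⟨fun l m => φ l * ψ l m, fun l m => mul_ne_zero (hφ l) (hψ l m), fun l m => ?_,
    fun l m => by simp only [hψh]; ring⟩
  refine int_forall_of_iff (P := fun m => φ (l + 1) * ψ (l + 1) m = f l m * (φ l * ψ l m))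
    (by simp [hψ0, hφf]) (fun m => ?_) m
  have h1 : φ (l + 1) * ψ (l + 1) (m + 1) = h (l + 1) m * (φ (l + 1) * ψ (l + 1) m) := by
    rw [hψh]; ring
  have h2 : f l (m + 1) * (φ l * ψ l (m + 1)) = h (l + 1) m * (f l m * (φ l * ψ l m)) := by
    rw [hψh]; linear_combination φ l * ψ l m * hfh l m
  rw [h1, h2, mul_right_inj' (hh _ _)]

/-- The equation behind `ρ = λ₃ ^ (-1) ^ m` and `σ = μ₃ ^ (-1) ^ l`. -/
theorem eq_zpow_negOnePow {f : ℤ → ℂ} (h : ∀ m, f (m + 1) * f m = 1) (m : ℤ) :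
    f m = f 0 ^ (m.negOnePow : ℤ) := by
  refine int_forall_of_iff (P := fun m => f m = f 0 ^ (m.negOnePow : ℤ)) (by simp) (fun m => ?_) m
  rw [eq_inv_of_mul_eq_one_left (h m), Int.negOnePow_succ, Units.val_neg, zpow_neg, inv_inj]

end Recursion

/-! ### Parameter functions and gauge transformations -/

section Params

variable (p : Params) (l m : ℤ)

theorem Params.rho_ne : p.rho l m ≠ 0 := zpow_ne_zero _ (p.lam3_ne l)

theorem Params.sigma_ne : p.sigma l m ≠ 0 := zpow_ne_zero _ (p.mu3_ne m)

theorem Params.rho_succ : p.rho l (m + 1) = (p.rho l m)⁻¹ := by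
  simp [Params.rho, Int.negOnePow_succ]

theorem Params.sigma_succ : p.sigma (l + 1) m = (p.sigma l m)⁻¹ := by
  simp [Params.sigma, Int.negOnePow_succ]

/-- Parameters with given `ρ` and `σ`, all others being one. -/
theorem Params.exists_of_rho_sigma {ρ σ : ℤ → ℤ → ℂ} (hρ : ∀ l m, ρ l m ≠ 0)
    (hσ : ∀ l m, σ l m ≠ 0) (hρ' : ∀ l m, ρ l (m + 1) * ρ l m = 1)
    (hσ' : ∀ l m, σ (l + 1) m * σ l m = 1) :
    ∃ p : Params, (∀ l, p.lam1 l = 1) ∧ (∀ l, p.lam2 l = 1) ∧ (∀ m, p.mu1 m = 1) ∧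
      (∀ m, p.mu2 m = 1) ∧ (∀ l m, p.rho l m = ρ l m) ∧ ∀ l m, p.sigma l m = σ l m :=
  ⟨⟨1, 1, fun l => ρ l 0, 1, 1, fun m => σ 0 m, by simp, by simp, fun l => hρ l 0, by simp,
    by simp, fun m => hσ 0 m⟩, by simp, by simp, by simp, by simp,
    fun l m => (eq_zpow_negOnePow (hρ' l) m).symm,
    fun l m => (eq_zpow_negOnePow (f := fun l => σ l m) (fun l => hσ' l m) l).symm⟩

end Params

/-- The entry `(i, j)` of the compatibility condition is multiplied by `ĝ̄ᵢ / gⱼ`. -/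
theorem IsSolution.gauge {s : Slot → F} {u : ℤ → ℤ → Slot → ℂ} (hu : IsSolution s u)
    {g : ℤ → ℤ → Fin 2 → ℂ} (hg : ∀ l m i, g l m i ≠ 0) : IsSolution s (gauge g u) := by
  refine ⟨?_, fun l m => ?_⟩
  · rintro l m (k | k) <;> simp [LaxClass.gauge, hu.1, hg]
  · have h := hu.2 l m
    rw [QuadCompatible, ← Matrix.ext_iff] at h ⊢
    intro i j
    have hL (l m k) : algebraMap ℂ F (g l m k) ≠ 0 := by simpa using hg l m k
    have := congrArg (fun z => algebraMap ℂ F (g (l + 1) (m + 1) i / g l m j) * z) (h i j)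
    simp only [Matrix.mul_apply, Fin.sum_univ_two, matL, matM, separable, Matrix.of_apply,
      LaxClass.gauge, Sum.elim_inl, Sum.elim_inr, map_mul, map_div₀] at this ⊢
    have h1 := hL l m
    have h2 := hL (l + 1) m
    have h3 := hL l (m + 1)
    have e1 := h1 0; have e2 := h1 1; have e3 := h2 0; have e4 := h2 1
    have e5 := h3 0; have e6 := h3 1; have e7 := h1 j
    field_simp at this ⊢
    linear_combination this

theorem gauge_gauge_inv (u : ℤ → ℤ → Slot → ℂ) {g : ℤ → ℤ → Fin 2 → ℂ}
    (hg : ∀ l m i, g l m i ≠ 0) : gauge g (gauge (fun l m i => (g l m i)⁻¹) u) = u := by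
  ext l m (k | k) <;> simp only [gauge, Sum.elim_inl, Sum.elim_inr]
  · have := hg (l + 1) m k.1; have := hg l m k.2
    field_simp
  · have := hg l (m + 1) k.1; have := hg l m k.2
    field_simp

/-! ### The systems of LSG₂ and LMKdV₂ -/

theorem lsg2Terms_eq (p : Params) (x y : ℤ → ℤ → ℂ) (l m : ℤ) :
    lsg2Terms p x y l m = slots (1 / p.rho l m) (p.lam1 l * x (l + 1) m) (p.lam2 l / x l m)
      (p.rho l m * y (l + 1) m / y l m) (x l (m + 1) / (p.sigma l m * x l m)) (p.mu2 m / y l m)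
      (p.mu1 m * y l (m + 1)) (p.sigma l m) := rfl

theorem lmkdv2Terms_eq (p : Params) (x y : ℤ → ℤ → ℂ) (l m : ℤ) :
    lmkdv2Terms p x y l m = slots (p.lam1 l * x (l + 1) m / x l m) (p.rho l m / y l m)
      (y (l + 1) m / p.rho l m) (p.lam2 l) (p.mu1 m * x l (m + 1) / x l m)
      (1 / (p.sigma l m * y l m)) (p.sigma l m * y l (m + 1)) (p.mu2 m) := rfl

theorem eq_slots (v : Slot → ℂ) :
    v = slots (v (.inl (0, 0))) (v (.inl (0, 1))) (v (.inl (1, 0))) (v (.inl (1, 1)))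
      (v (.inr (0, 0))) (v (.inr (0, 1))) (v (.inr (1, 0))) (v (.inr (1, 1))) := by
  ext (⟨i, j⟩ | ⟨i, j⟩) <;> fin_cases i <;> fin_cases j <;> rfl

theorem slots_ne_zero {a b c d α β γ δ : ℂ} (ha : a ≠ 0) (hb : b ≠ 0) (hc : c ≠ 0) (hd : d ≠ 0)
    (hα : α ≠ 0) (hβ : β ≠ 0) (hγ : γ ≠ 0) (hδ : δ ≠ 0) (k : Slot) :
    slots a b c d α β γ δ k ≠ 0 := by
  rcases k with ⟨i, j⟩ | ⟨i, j⟩ <;> fin_cases i <;> fin_cases j <;> simpa [slots]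

/-- Spectral terms whose system is that of the Lax pair of LSG₂ (constants have been absorbed, so
that proportional spectral products are equal). Field names refer to the lattice terms. -/
structure IsLSG2Spectral (s : Slot → F) : Prop where
  ne : ∀ k, s k ≠ 0
  d_eq : s (.inl (1, 1)) = s (.inl (0, 0))
  δ_eq : s (.inr (1, 1)) = s (.inr (0, 0))
  bγ_eq : s (.inl (0, 1)) * s (.inr (1, 0)) = s (.inl (0, 0)) * s (.inr (0, 0))
  cβ_eq : s (.inl (1, 0)) * s (.inr (0, 1)) = s (.inl (0, 0)) * s (.inr (0, 0))
  indep : ¬ Proportional (s (.inl (0, 0)) * s (.inr (0, 1))) (s (.inl (0, 1)) * s (.inr (0, 0)))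

/-- Spectral terms whose system is that of the Lax pair of LMKdV₂ (constants have been absorbed, so
that proportional spectral products are equal). Field names refer to the lattice terms. -/
structure IsLMKdV2Spectral (s : Slot → F) : Prop where
  ne : ∀ k, s k ≠ 0
  d_eq : s (.inl (1, 1)) = s (.inl (0, 0))
  δ_eq : s (.inr (1, 1)) = s (.inr (0, 0))
  cβ_eq : s (.inl (1, 0)) * s (.inr (0, 1)) = s (.inl (0, 1)) * s (.inr (1, 0))
  aβ_eq : s (.inl (0, 0)) * s (.inr (0, 1)) = s (.inl (0, 1)) * s (.inr (0, 0))
  indep : ¬ Proportional (s (.inl (0, 0)) * s (.inr (0, 0))) (s (.inl (0, 1)) * s (.inr (1, 0)))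

theorem smul_add_smul_eq_zero_iff {V : Type*} [AddCommGroup V] [Module ℂ V] {f g : V} (hf : f ≠ 0)
    (hfg : ¬ Proportional f g) {x y : ℂ} : x • f + y • g = 0 ↔ x = 0 ∧ y = 0 :=
  ⟨eq_zero_of_not_proportional hf hfg, by rintro ⟨rfl, rfl⟩; simp⟩

theorem IsLSG2Spectral.quadCompatible_slots_iff {s : Slot → F} (hs : IsLSG2Spectral s)
    (a b c d α β γ δ a₁ b₁ c₁ d₁ α₁ β₁ γ₁ δ₁ a₂ b₂ c₂ d₂ α₂ β₂ γ₂ δ₂ : ℂ) :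
    QuadCompatible s (slots a b c d α β γ δ) (slots a₂ b₂ c₂ d₂ α₂ β₂ γ₂ δ₂)
      (slots a₁ b₁ c₁ d₁ α₁ β₁ γ₁ δ₁) ↔
    a₂ * β = β₁ * d ∧ b₂ * δ = α₁ * b ∧ c₂ * α = δ₁ * c ∧ d₂ * γ = γ₁ * a ∧
      a₂ * α + b₂ * γ = α₁ * a + β₁ * c ∧ c₂ * β + d₂ * δ = γ₁ * b + δ₁ * d := by
  have h2 (k l : Slot) : s k * s l ≠ 0 := mul_ne_zero (hs.ne k) (hs.ne l)
  have hind : ¬ Proportional (s (.inl (0, 0)) * s (.inr (1, 0)))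
      (s (.inl (1, 0)) * s (.inr (0, 0))) := by
    rintro ⟨k, hk⟩
    refine hs.indep ⟨k, mul_left_cancel₀ (h2 (.inl (1, 0)) (.inr (1, 0))) ?_⟩
    rw [Algebra.smul_def] at hk ⊢
    linear_combination s (.inl (0, 0)) * s (.inr (0, 0)) * hk +
      s (.inl (1, 0)) * s (.inr (0, 0)) * hs.bγ_eq -
      algebraMap ℂ F k * s (.inl (0, 0)) * s (.inr (1, 0)) * hs.cβ_eq
  have e1 (x y z : ℂ) (P : F) (hP : P ≠ 0) : x • P + y • P - z • P = 0 ↔ x + y - z = 0 := by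
    rw [← add_smul, ← sub_smul, smul_eq_zero_iff_left hP]
  have e2 (x y z t : ℂ) (P Q : F) (hP : P ≠ 0) (hPQ : ¬ Proportional P Q) :
      x • P + y • Q - z • Q - t • P = 0 ↔ x = t ∧ y = z := by
    rw [← sub_eq_zero (a := x), ← sub_eq_zero (a := y), ← smul_add_smul_eq_zero_iff hP hPQ]
    congr! 1
    module
  rw [LaxClass.quadCompatible_iff]
  simp only [RowCompatible, hs.d_eq, hs.δ_eq, hs.bγ_eq, hs.cβ_eq]
  rw [e1 _ _ _ _ (h2 _ _), e1 _ _ _ _ (h2 _ _), e2 _ _ _ _ _ _ (h2 _ _) hs.indep,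
    e2 _ _ _ _ _ _ (h2 _ _) hind]
  simp only [slots, swapIndices]
  simp
  constructor
  · rintro ⟨⟨h1, h2, h3⟩, h4, h5, h6⟩
    exact ⟨h2, h3, h6, h5, by linear_combination h1, by linear_combination h4⟩
  · rintro ⟨h1, h2, h3, h4, h5, h6⟩
    exact ⟨⟨by linear_combination h5, h1, h2⟩, by linear_combination h6, h4, h3⟩

theorem IsLSG2Spectral.quadCompatible_iff {s : Slot → F} (hs : IsLSG2Spectral s)
    (v vHat vBar : Slot → ℂ) :
    QuadCompatible s v vHat vBar ↔
      vHat (.inl (0, 0)) * v (.inr (0, 1)) = vBar (.inr (0, 1)) * v (.inl (1, 1)) ∧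
      vHat (.inl (0, 1)) * v (.inr (1, 1)) = vBar (.inr (0, 0)) * v (.inl (0, 1)) ∧
      vHat (.inl (1, 0)) * v (.inr (0, 0)) = vBar (.inr (1, 1)) * v (.inl (1, 0)) ∧
      vHat (.inl (1, 1)) * v (.inr (1, 0)) = vBar (.inr (1, 0)) * v (.inl (0, 0)) ∧
      vHat (.inl (0, 0)) * v (.inr (0, 0)) + vHat (.inl (0, 1)) * v (.inr (1, 0)) =
        vBar (.inr (0, 0)) * v (.inl (0, 0)) + vBar (.inr (0, 1)) * v (.inl (1, 0)) ∧
      vHat (.inl (1, 0)) * v (.inr (0, 1)) + vHat (.inl (1, 1)) * v (.inr (1, 1)) =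
        vBar (.inr (1, 0)) * v (.inl (0, 1)) + vBar (.inr (1, 1)) * v (.inl (1, 1)) := by
  rw [eq_slots v, eq_slots vHat, eq_slots vBar]
  exact hs.quadCompatible_slots_iff ..

theorem IsLMKdV2Spectral.quadCompatible_slots_iff {s : Slot → F} (hs : IsLMKdV2Spectral s)
    (a b c d α β γ δ a₁ b₁ c₁ d₁ α₁ β₁ γ₁ δ₁ a₂ b₂ c₂ d₂ α₂ β₂ γ₂ δ₂ : ℂ) :
    QuadCompatible s (slots a b c d α β γ δ) (slots a₂ b₂ c₂ d₂ α₂ β₂ γ₂ δ₂)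
      (slots a₁ b₁ c₁ d₁ α₁ β₁ γ₁ δ₁) ↔
    a₂ * α = α₁ * a ∧ b₂ * γ = β₁ * c ∧ c₂ * β = γ₁ * b ∧ d₂ * δ = δ₁ * d ∧
      a₂ * β + b₂ * δ = α₁ * b + β₁ * d ∧ c₂ * α + d₂ * γ = γ₁ * a + δ₁ * c := by
  have h2 (k l : Slot) : s k * s l ≠ 0 := mul_ne_zero (hs.ne k) (hs.ne l)
  have hca : s (.inl (1, 0)) * s (.inr (0, 0)) = s (.inl (0, 0)) * s (.inr (1, 0)) := by
    refine mul_left_cancel₀ (h2 (.inl (0, 1)) (.inr (0, 1))) ?_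
    linear_combination s (.inl (0, 1)) * s (.inr (0, 0)) * hs.cβ_eq -
      s (.inl (0, 1)) * s (.inr (1, 0)) * hs.aβ_eq
  have e1 (x y z t : ℂ) (P : F) (hP : P ≠ 0) :
      x • P + y • P - z • P - t • P = 0 ↔ x + y - z - t = 0 := by
    rw [← add_smul, ← sub_smul, ← sub_smul, smul_eq_zero_iff_left hP]
  have e2 (x y z : ℂ) (P Q : F) (hP : P ≠ 0) (hPQ : ¬ Proportional P Q) :
      x • P + y • Q - z • Q = 0 ↔ x = 0 ∧ y = z := by
    rw [← sub_eq_zero (a := y), ← smul_add_smul_eq_zero_iff hP hPQ]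
    congr! 1
    module
  rw [LaxClass.quadCompatible_iff]
  simp only [RowCompatible, hs.d_eq, hs.δ_eq, hs.aβ_eq, hs.cβ_eq, hca]
  rw [e1 _ _ _ _ _ (h2 _ _), e1 _ _ _ _ _ (h2 _ _), e2 _ _ _ _ _ (h2 _ _) hs.indep,
    e2 _ _ _ _ _ (h2 _ _) hs.indep]
  simp only [slots, swapIndices]
  simp
  constructor
  · rintro ⟨⟨⟨h1, h2⟩, h3⟩, ⟨h4, h5⟩, h6⟩
    exact ⟨by linear_combination h1, h2, h5, by linear_combination h4,
      by linear_combination h3, by linear_combination h6⟩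
  · rintro ⟨h1, h2, h3, h4, h5, h6⟩
    exact ⟨⟨⟨by linear_combination h1, h2⟩, by linear_combination h5⟩,
      ⟨by linear_combination h4, h3⟩, by linear_combination h6⟩

theorem IsLMKdV2Spectral.quadCompatible_iff {s : Slot → F} (hs : IsLMKdV2Spectral s)
    (v vHat vBar : Slot → ℂ) :
    QuadCompatible s v vHat vBar ↔
      vHat (.inl (0, 0)) * v (.inr (0, 0)) = vBar (.inr (0, 0)) * v (.inl (0, 0)) ∧
      vHat (.inl (0, 1)) * v (.inr (1, 0)) = vBar (.inr (0, 1)) * v (.inl (1, 0)) ∧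
      vHat (.inl (1, 0)) * v (.inr (0, 1)) = vBar (.inr (1, 0)) * v (.inl (0, 1)) ∧
      vHat (.inl (1, 1)) * v (.inr (1, 1)) = vBar (.inr (1, 1)) * v (.inl (1, 1)) ∧
      vHat (.inl (0, 0)) * v (.inr (0, 1)) + vHat (.inl (0, 1)) * v (.inr (1, 1)) =
        vBar (.inr (0, 0)) * v (.inl (0, 1)) + vBar (.inr (0, 1)) * v (.inl (1, 1)) ∧
      vHat (.inl (1, 0)) * v (.inr (0, 0)) + vHat (.inl (1, 1)) * v (.inr (1, 0)) =
        vBar (.inr (1, 0)) * v (.inl (0, 0)) + vBar (.inr (1, 1)) * v (.inl (1, 0)) := by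
  rw [eq_slots v, eq_slots vHat, eq_slots vBar]
  exact hs.quadCompatible_slots_iff ..

theorem IsLSG2Spectral.isSolution_terms {s : Slot → F} (hs : IsLSG2Spectral s) {p : Params}
    {x y : ℤ → ℤ → ℂ} (hx : ∀ l m, x l m ≠ 0) (hy : ∀ l m, y l m ≠ 0) :
    IsSolution s (lsg2Terms p x y) ↔ LSG2 p x y := by
  have hρ := p.rho_ne
  have hσ := p.sigma_ne
  have h0 : ∀ l m k, lsg2Terms p x y l m k ≠ 0 := fun l m k => by
    rw [lsg2Terms_eq]
    apply slots_ne_zero <;> simp [*, p.lam1_ne, p.lam2_ne, p.mu1_ne, p.mu2_ne]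
  refine (and_iff_right h0).trans (forall₂_congr fun l m => ?_)
  simp only [lsg2Terms_eq, hs.quadCompatible_slots_iff, p.rho_succ, p.sigma_succ]
  have := hρ l m; have := hσ l m
  have := hx l m; have := hx (l + 1) m; have := hx l (m + 1); have := hx (l + 1) (m + 1)
  have := hy l m; have := hy (l + 1) m; have := hy l (m + 1); have := hy (l + 1) (m + 1)
  rw [and_iff_right (by field_simp), and_iff_right (by field_simp), and_iff_right (by field_simp),
    and_iff_right (by field_simp)]
  congr! 2
  · field_simp
  · field_simp
  · field_simp
    ring
  · field_simp
    ring

theorem IsLMKdV2Spectral.isSolution_terms {s : Slot → F} (hs : IsLMKdV2Spectral s) {p : Params}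
    {x y : ℤ → ℤ → ℂ} (hx : ∀ l m, x l m ≠ 0) (hy : ∀ l m, y l m ≠ 0) :
    IsSolution s (lmkdv2Terms p x y) ↔ LMKdV2 p x y := by
  have hρ := p.rho_ne
  have hσ := p.sigma_ne
  have h0 : ∀ l m k, lmkdv2Terms p x y l m k ≠ 0 := fun l m k => by
    rw [lmkdv2Terms_eq]
    apply slots_ne_zero <;> simp [*, p.lam1_ne, p.lam2_ne, p.mu1_ne, p.mu2_ne]
  refine (and_iff_right h0).trans (forall₂_congr fun l m => ?_)
  simp only [lmkdv2Terms_eq, hs.quadCompatible_slots_iff, p.rho_succ, p.sigma_succ]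
  have := hρ l m; have := hσ l m
  have := hx l m; have := hx (l + 1) m; have := hx l (m + 1); have := hx (l + 1) (m + 1)
  have := hy l m; have := hy (l + 1) m; have := hy l (m + 1); have := hy (l + 1) (m + 1)
  rw [and_iff_right (by field_simp), and_iff_right (by field_simp), and_iff_right (by field_simp),
    and_iff_right (by field_simp)]
  refine and_congr ?_ ?_
  · rw [← mul_right_inj' (hy l m)]
    congr! 1
    · field_simp
    · field_simp
      ring
  · rw [← mul_right_inj' (hx l m)]
    congr! 1
    · field_simp
    · field_simp
      ring

/-- The normal form of a solution after the gauge has been fixed by `c = 1 / x`, `β = 1 / y`. The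
first two equations of the system become `a â = 1` and `δ δ̄ = 1`, which is the form of `1 / ρ`
and `σ`. -/
theorem IsLSG2Spectral.exists_terms_eq {s : Slot → F} (hs : IsLSG2Spectral s)
    {u : ℤ → ℤ → Slot → ℂ} (hu : IsSolution s u) {x y : ℤ → ℤ → ℂ} (hx : ∀ l m, x l m ≠ 0)
    (hy : ∀ l m, y l m ≠ 0)
    (had : ∀ l m, u l m (.inl (0, 0)) * u l m (.inl (1, 1)) * y l m = y (l + 1) m)
    (hβγ : ∀ l m, u l m (.inr (0, 1)) * u l m (.inr (1, 0)) * y l m = y l (m + 1))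
    (hbc : ∀ l m, u l m (.inl (0, 1)) * u l m (.inl (1, 0)) * x l m = x (l + 1) m)
    (hαδ : ∀ l m, u l m (.inr (0, 0)) * u l m (.inr (1, 1)) * x l m = x l (m + 1))
    (hc : ∀ l m, u l m (.inl (1, 0)) * x l m = 1)
    (hβ : ∀ l m, u l m (.inr (0, 1)) * y l m = 1) :
    ∃ p : Params, u = lsg2Terms p x y := by
  obtain ⟨a, b, c, d, α, β, γ, δ, rfl⟩ : ∃ a b c d α β γ δ : ℤ → ℤ → ℂ, u = fun l m =>
      slots (a l m) (b l m) (c l m) (d l m) (α l m) (β l m) (γ l m) (δ l m) :=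
    ⟨_, _, _, _, _, _, _, _, funext₂ fun l m => eq_slots (u l m)⟩
  have ha (l m) : a l m ≠ 0 := hu.1 l m (.inl (0, 0))
  have hδ (l m) : δ l m ≠ 0 := hu.1 l m (.inr (1, 1))
  have hN (l m) := (hs.quadCompatible_slots_iff ..).1 (hu.2 l m)
  replace had (l m) : a l m * d l m * y l m = y (l + 1) m := had l m
  replace hβγ (l m) : β l m * γ l m * y l m = y l (m + 1) := hβγ l m
  replace hbc (l m) : b l m * c l m * x l m = x (l + 1) m := hbc l m
  replace hαδ (l m) : α l m * δ l m * x l m = x l (m + 1) := hαδ l m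
  replace hc (l m) : c l m * x l m = 1 := hc l m
  replace hβ (l m) : β l m * y l m = 1 := hβ l m
  have hb (l m) : b l m = x (l + 1) m := by linear_combination hbc l m - b l m * hc l m
  have hγ (l m) : γ l m = y l (m + 1) := by linear_combination hβγ l m - γ l m * hβ l m
  have haa (l m) : a l (m + 1) * a l m = 1 := by
    linear_combination (-a l (m + 1) * a l m) * hβ l m + a l m * y l m * (hN l m).1 +
      β (l + 1) m * had l m + hβ (l + 1) m
  have hδδ (l m) : δ (l + 1) m * δ l m = 1 := by
    have h := (hN l m).2.1
    rw [hb, hb] at h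
    refine mul_left_cancel₀ (hx (l + 1) (m + 1)) ?_
    linear_combination δ (l + 1) m * h + hαδ (l + 1) m
  obtain ⟨p, h1, h2, h3, h4, hp, hp'⟩ := Params.exists_of_rho_sigma
    (ρ := fun l m => (a l m)⁻¹) (σ := δ) (fun l m => inv_ne_zero (ha l m)) hδ
    (fun l m => by rw [← mul_inv, haa, inv_one]) hδδ
  refine ⟨p, funext₂ fun l m => ?_⟩
  have := ha l m; have := hx l m; have := hy l m; have := hδ l m
  rw [lsg2Terms_eq, h1, h2, h3, h4, hp, hp', one_mul, one_mul, ← hb, ← hγ, ← hαδ, ← had,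
    eq_div_of_mul_eq (hx l m) (hc l m), eq_div_of_mul_eq (hy l m) (hβ l m)]
  congr 1 <;> field_simp

/-- The normal form of a solution after the gauge has been fixed by `d = δ = 1` and by `ρ ρ̂ = 1`
for `ρ = b y`. The equation `b̂ γ = β̄ c` reads `ρ ρ̂ σ σ̄ = 1` for `σ = 1 / (β y)`, whence
`σ σ̄ = 1`. -/
theorem IsLMKdV2Spectral.exists_terms_eq {s : Slot → F} (hs : IsLMKdV2Spectral s)
    {u : ℤ → ℤ → Slot → ℂ} (hu : IsSolution s u) {x y : ℤ → ℤ → ℂ} (hx : ∀ l m, x l m ≠ 0)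
    (hy : ∀ l m, y l m ≠ 0)
    (ha : ∀ l m, u l m (.inl (0, 0)) * x l m = x (l + 1) m)
    (hα : ∀ l m, u l m (.inr (0, 0)) * x l m = x l (m + 1))
    (hd : ∀ l m, u l m (.inl (1, 1)) = 1)
    (hδ : ∀ l m, u l m (.inr (1, 1)) = 1)
    (hbc : ∀ l m, u l m (.inl (0, 1)) * u l m (.inl (1, 0)) * y l m = y (l + 1) m)
    (hβγ : ∀ l m, u l m (.inr (0, 1)) * u l m (.inr (1, 0)) * y l m = y l (m + 1))
    (hb : ∀ l m, u l (m + 1) (.inl (0, 1)) * y l (m + 1) * (u l m (.inl (0, 1)) * y l m) = 1) :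
    ∃ p : Params, u = lmkdv2Terms p x y := by
  obtain ⟨a, b, c, d, α, β, γ, δ, rfl⟩ : ∃ a b c d α β γ δ : ℤ → ℤ → ℂ, u = fun l m =>
      slots (a l m) (b l m) (c l m) (d l m) (α l m) (β l m) (γ l m) (δ l m) :=
    ⟨_, _, _, _, _, _, _, _, funext₂ fun l m => eq_slots (u l m)⟩
  have hb0 (l m) : b l m ≠ 0 := hu.1 l m (.inl (0, 1))
  have hβ0 (l m) : β l m ≠ 0 := hu.1 l m (.inr (0, 1))
  have hγ0 (l m) : γ l m ≠ 0 := hu.1 l m (.inr (1, 0))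
  have hN (l m) := (hs.quadCompatible_slots_iff ..).1 (hu.2 l m)
  replace ha (l m) : a l m * x l m = x (l + 1) m := ha l m
  replace hα (l m) : α l m * x l m = x l (m + 1) := hα l m
  replace hd (l m) : d l m = 1 := hd l m
  replace hδ (l m) : δ l m = 1 := hδ l m
  replace hbc (l m) : b l m * c l m * y l m = y (l + 1) m := hbc l m
  replace hβγ (l m) : β l m * γ l m * y l m = y l (m + 1) := hβγ l m
  replace hb (l m) : b l (m + 1) * y l (m + 1) * (b l m * y l m) = 1 := hb l m
  have hββ (l m) : β (l + 1) m * y (l + 1) m * (β l m * y l m) = 1 := by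
    have h := (hN l m).2.1
    rw [← hbc, ← hb l m, ← hβγ]
    linear_combination -(β l m * y l m ^ 2 * b l m) * h
  obtain ⟨p, h1, h2, h3, h4, hp, hp'⟩ := Params.exists_of_rho_sigma
    (ρ := fun l m => b l m * y l m) (σ := fun l m => (β l m * y l m)⁻¹)
    (fun l m => mul_ne_zero (hb0 l m) (hy l m))
    (fun l m => inv_ne_zero (mul_ne_zero (hβ0 l m) (hy l m))) hb
    (fun l m => by rw [← mul_inv, hββ, inv_one])
  refine ⟨p, funext₂ fun l m => ?_⟩
  have := hx l m; have := hy l m; have := hb0 l m; have := hβ0 l m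
  rw [lmkdv2Terms_eq, h1, h2, h3, h4, hp, hp', ← ha, ← hα, ← hbc, ← hβγ, hd, hδ]
  congr 1 <;> field_simp

/-- The parameters `λ₁, λ₂, μ₁, μ₂` can be taken to be one: they are absorbed by `x`, `y` and the
gauge. -/
theorem IsLSG2Spectral.isSolution_iff {s : Slot → F} (hs : IsLSG2Spectral s)
    (u : ℤ → ℤ → Slot → ℂ) :
    IsSolution s u ↔ ∃ (p : Params) (x y : ℤ → ℤ → ℂ) (g : ℤ → ℤ → Fin 2 → ℂ),
      (∀ l m, x l m ≠ 0) ∧ (∀ l m, y l m ≠ 0) ∧ (∀ l m i, g l m i ≠ 0) ∧ LSG2 p x y ∧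
      ∀ l m k, u l m k = gauge g (lsg2Terms p x y) l m k := by
  constructor
  · intro hu
    have hne := hu.1
    have hN (l m) := (hs.quadCompatible_iff ..).1 (hu.2 l m)
    obtain ⟨φ, hφ, hφl, hφm⟩ := exists_potential
      (f := fun l m => u l m (.inl (0, 0)) * u l m (.inl (1, 1)))
      (h := fun l m => u l m (.inr (0, 1)) * u l m (.inr (1, 0)))
      (fun l m => mul_ne_zero (hne _ _ _) (hne _ _ _))
      (fun l m => mul_ne_zero (hne _ _ _) (hne _ _ _)) (fun l m => by
        obtain ⟨h1, h2, h3, h4, -⟩ := hN l m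
        linear_combination u l (m + 1) (.inl (1, 1)) * u l m (.inr (1, 0)) * h1 +
          u (l + 1) m (.inr (0, 1)) * u l m (.inl (1, 1)) * h4)
    obtain ⟨ψ, hψ, hψl, hψm⟩ := exists_potential
      (f := fun l m => u l m (.inl (0, 1)) * u l m (.inl (1, 0)))
      (h := fun l m => u l m (.inr (0, 0)) * u l m (.inr (1, 1)))
      (fun l m => mul_ne_zero (hne _ _ _) (hne _ _ _))
      (fun l m => mul_ne_zero (hne _ _ _) (hne _ _ _)) (fun l m => by
        obtain ⟨h1, h2, h3, h4, -⟩ := hN l m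
        linear_combination u l (m + 1) (.inl (1, 0)) * u l m (.inr (0, 0)) * h2 +
          u (l + 1) m (.inr (0, 0)) * u l m (.inl (0, 1)) * h3)
    -- For `x = ψ / (g₀ g₁)` and `y = φ / (g₀ g₁)`, the gauge conditions `c = 1 / x` and `β = 1 / y`
    -- on the transformed terms decouple into recursions for `g₁` along `l` and for `g₀` along `m`.
    choose g₁ hg₁ hg₁l using fun m => exists_product
      (f := fun l => u l m (.inl (1, 0)) * ψ l m) (fun l => mul_ne_zero (hne _ _ _) (hψ _ _))
    choose g₀ hg₀ hg₀m using fun l => exists_product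
      (f := fun m => u l m (.inr (0, 1)) * φ l m) (fun m => mul_ne_zero (hne _ _ _) (hφ _ _))
    obtain ⟨g, hg0, hg1⟩ : ∃ g : ℤ → ℤ → Fin 2 → ℂ, (∀ l m, g l m 0 = g₀ l m) ∧
        ∀ l m, g l m 1 = g₁ m l := ⟨fun l m => ![g₀ l m, g₁ m l], fun _ _ => rfl, fun _ _ => rfl⟩
    have hg (l m i) : g l m i ≠ 0 := by
      fin_cases i
      · exact (hg0 l m).symm ▸ hg₀ l m
      · exact (hg1 l m).symm ▸ hg₁ m l
    have hx (l m) : ψ l m / (g l m 0 * g l m 1) ≠ 0 :=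
      div_ne_zero (hψ l m) (mul_ne_zero (hg l m 0) (hg l m 1))
    have hy (l m) : φ l m / (g l m 0 * g l m 1) ≠ 0 :=
      div_ne_zero (hφ l m) (mul_ne_zero (hg l m 0) (hg l m 1))
    have hv := hu.gauge (g := fun l m i => (g l m i)⁻¹) fun l m i => inv_ne_zero (hg l m i)
    obtain ⟨p, hp⟩ := hs.exists_terms_eq hv hx hy
      (fun l m => by
        have := hg (l + 1) m 0; have := hg (l + 1) m 1; have := hg l m 0; have := hg l m 1
        simp only [gauge, Sum.elim_inl, hφl]
        field_simp)
      (fun l m => by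
        have := hg l (m + 1) 0; have := hg l (m + 1) 1; have := hg l m 0; have := hg l m 1
        simp only [gauge, Sum.elim_inr, hφm]
        field_simp)
      (fun l m => by
        have := hg (l + 1) m 0; have := hg (l + 1) m 1; have := hg l m 0; have := hg l m 1
        simp only [gauge, Sum.elim_inl, hψl]
        field_simp)
      (fun l m => by
        have := hg l (m + 1) 0; have := hg l (m + 1) 1; have := hg l m 0; have := hg l m 1
        simp only [gauge, Sum.elim_inr, hψm]
        field_simp)
      (fun l m => by
        have := hg (l + 1) m 1; have := hg l m 0; have := hg l m 1
        have h := hg₁l m l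
        rw [← hg1, ← hg1] at h
        simp only [gauge, Sum.elim_inl]
        field_simp
        linear_combination -h)
      (fun l m => by
        have := hg l (m + 1) 0; have := hg l m 0; have := hg l m 1
        have h := hg₀m l m
        rw [← hg0, ← hg0] at h
        simp only [gauge, Sum.elim_inr]
        field_simp
        linear_combination -h)
    refine ⟨p, _, _, g, hx, hy, hg, ?_, fun l m k => ?_⟩
    · rwa [hp, hs.isSolution_terms hx hy] at hv
    · rw [← hp, gauge_gauge_inv u hg]
  · rintro ⟨p, x, y, g, hx, hy, hg, h, hu⟩
    rw [show u = gauge g (lsg2Terms p x y) from funext₂ fun l m => funext (hu l m)]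
    exact ((hs.isSolution_terms hx hy).2 h).gauge hg

/-- The parameters `λ₁, λ₂, μ₁, μ₂` can be taken to be one: they are absorbed by `x`, `y` and the
gauge. -/
theorem IsLMKdV2Spectral.isSolution_iff {s : Slot → F} (hs : IsLMKdV2Spectral s)
    (u : ℤ → ℤ → Slot → ℂ) :
    IsSolution s u ↔ ∃ (p : Params) (x y : ℤ → ℤ → ℂ) (g : ℤ → ℤ → Fin 2 → ℂ),
      (∀ l m, x l m ≠ 0) ∧ (∀ l m, y l m ≠ 0) ∧ (∀ l m i, g l m i ≠ 0) ∧ LMKdV2 p x y ∧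
      ∀ l m k, u l m k = gauge g (lmkdv2Terms p x y) l m k := by
  constructor
  · intro hu
    have hne := hu.1
    have hN (l m) := (hs.quadCompatible_iff ..).1 (hu.2 l m)
    obtain ⟨θ, hθ, hθl, hθm⟩ := exists_potential (f := fun l m => u l m (.inl (0, 0)))
      (h := fun l m => u l m (.inr (0, 0))) (fun l m => hne _ _ _) (fun l m => hne _ _ _)
      (fun l m => (hN l m).1)
    obtain ⟨g₁, hg₁, hg₁l, hg₁m⟩ := exists_potential (f := fun l m => u l m (.inl (1, 1)))
      (h := fun l m => u l m (.inr (1, 1))) (fun l m => hne _ _ _) (fun l m => hne _ _ _)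
      (fun l m => (hN l m).2.2.2.1)
    obtain ⟨φ, hφ, hφl, hφm⟩ := exists_potential
      (f := fun l m => u l m (.inl (0, 1)) * u l m (.inl (1, 0)))
      (h := fun l m => u l m (.inr (0, 1)) * u l m (.inr (1, 0)))
      (fun l m => mul_ne_zero (hne _ _ _) (hne _ _ _))
      (fun l m => mul_ne_zero (hne _ _ _) (hne _ _ _)) (fun l m => by
        obtain ⟨-, h2, h3, -⟩ := hN l m
        linear_combination u l (m + 1) (.inl (1, 0)) * u l m (.inr (0, 1)) * h2 +
          u (l + 1) m (.inr (0, 1)) * u l m (.inl (1, 0)) * h3)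
    -- For `y = φ / (g₀ g₁)` and `ρ = b φ / (g₀ ḡ₀)`, the gauge condition `ρ ρ̂ = 1` prescribes
    -- `H Ĥ` for `H = g₀ ḡ₀`.
    choose H hH hHm using fun l => exists_product
      (f := fun m => u l (m + 1) (.inl (0, 1)) * φ l (m + 1) * (u l m (.inl (0, 1)) * φ l m))
      (fun m => mul_ne_zero (mul_ne_zero (hne _ _ _) (hφ _ _)) (mul_ne_zero (hne _ _ _) (hφ _ _)))
    choose g₀ hg₀ hg₀l using fun m => exists_product (f := fun l => H l m) fun l => hH l m
    obtain ⟨g, hg0, hg1⟩ : ∃ g : ℤ → ℤ → Fin 2 → ℂ, (∀ l m, g l m 0 = g₀ m l) ∧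
        ∀ l m, g l m 1 = g₁ l m := ⟨fun l m => ![g₀ m l, g₁ l m], fun _ _ => rfl, fun _ _ => rfl⟩
    have hg (l m i) : g l m i ≠ 0 := by
      fin_cases i
      · exact (hg0 l m).symm ▸ hg₀ m l
      · exact (hg1 l m).symm ▸ hg₁ l m
    have hx (l m) : θ l m / g l m 0 ≠ 0 := div_ne_zero (hθ l m) (hg l m 0)
    have hy (l m) : φ l m / (g l m 0 * g l m 1) ≠ 0 :=
      div_ne_zero (hφ l m) (mul_ne_zero (hg l m 0) (hg l m 1))
    have hv := hu.gauge (g := fun l m i => (g l m i)⁻¹) fun l m i => inv_ne_zero (hg l m i)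
    obtain ⟨p, hp⟩ := hs.exists_terms_eq hv hx hy
      (fun l m => by
        have := hg (l + 1) m 0; have := hg l m 0
        simp only [gauge, Sum.elim_inl, hθl]
        field_simp)
      (fun l m => by
        have := hg l (m + 1) 0; have := hg l m 0
        simp only [gauge, Sum.elim_inr, hθm]
        field_simp)
      (fun l m => by
        have := hg₁ l m; have := hne l m (.inl (1, 1))
        simp only [gauge, Sum.elim_inl, hg1, hg₁l]
        field_simp)
      (fun l m => by
        have := hg₁ l m; have := hne l m (.inr (1, 1))
        simp only [gauge, Sum.elim_inr, hg1, hg₁m]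
        field_simp)
      (fun l m => by
        have := hg (l + 1) m 0; have := hg (l + 1) m 1; have := hg l m 0; have := hg l m 1
        simp only [gauge, Sum.elim_inl, hφl]
        field_simp)
      (fun l m => by
        have := hg l (m + 1) 0; have := hg l (m + 1) 1; have := hg l m 0; have := hg l m 1
        simp only [gauge, Sum.elim_inr, hφm]
        field_simp)
      (fun l m => by
        have := hg l (m + 1) 0; have := hg l (m + 1) 1; have := hg l m 0; have := hg l m 1
        have := hg (l + 1) m 0; have := hg (l + 1) (m + 1) 0
        have h := hHm l m
        rw [← hg₀l, ← hg₀l, ← hg0, ← hg0, ← hg0, ← hg0] at h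
        simp only [gauge, Sum.elim_inl]
        field_simp
        linear_combination -h)
    refine ⟨p, _, _, g, hx, hy, hg, ?_, fun l m k => ?_⟩
    · rwa [hp, hs.isSolution_terms hx hy] at hv
    · rw [← hp, gauge_gauge_inv u hg]
  · rintro ⟨p, x, y, g, hx, hy, hg, h, hu⟩
    rw [show u = gauge g (lmkdv2Terms p x y) from funext₂ fun l m => funext (hu l m)]
    exact ((hs.isSolution_terms hx hy).2 h).gauge hg

/-! ### Systems of at most six equations -/

theorem exists_combination_of_finrank_span_le_two {V : Type*} [AddCommGroup V] [Module ℂ V]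
    {S : Set V} (hS : S.Finite) (h2 : Module.finrank ℂ (Submodule.span ℂ S) ≤ 2) {f g h : V}
    (hf : f ∈ S) (hg : g ∈ S) (hh : h ∈ S) (hf0 : f ≠ 0) (hfg : ¬ Proportional f g) :
    ∃ x y : ℂ, x • f + y • g = h := by
  have := FiniteDimensional.span_of_finite ℂ hS
  have hle : Submodule.span ℂ {f, g} ≤ Submodule.span ℂ S :=
    Submodule.span_mono (Set.insert_subset hf (Set.singleton_subset_iff.2 hg))
  have h1 : ¬ Module.finrank ℂ (Submodule.span ℂ {f, g}) ≤ 1 := fun h1 => hfg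
    (proportional_of_finrank_span_le_one (Set.toFinite _) h1 (by simp) (by simp) hf0)
  have heq := Submodule.eq_of_le_of_finrank_le hle (by omega)
  exact Submodule.mem_span_pair.1 (heq ▸ Submodule.subset_span hh)

/-- As `ℂ` is algebraically closed, a non-constant element satisfies no quadratic equation. -/
theorem proportional_of_quadratic {A D : F} {x y z : ℂ} (hx : x ≠ 0)
    (h : x • (A * A) + y • (A * D) + z • (D * D) = 0) : Proportional D A := by
  obtain ⟨w, hw⟩ := IsAlgClosed.exists_pow_nat_eq (y ^ 2 - 4 * x * z) two_pos
  have hw' := congrArg (algebraMap ℂ F) hw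
  have hx' : algebraMap ℂ F x ≠ 0 := by simpa using hx
  have : CharZero F := charZero_of_injective_algebraMap (algebraMap ℂ F).injective
  simp only [map_pow, map_sub, map_mul, Algebra.smul_def, map_ofNat] at hw' h
  have hprod : (2 * algebraMap ℂ F x * A + (algebraMap ℂ F y - algebraMap ℂ F w) * D) *
      (2 * algebraMap ℂ F x * A + (algebraMap ℂ F y + algebraMap ℂ F w) * D) = 0 := by
    linear_combination 4 * algebraMap ℂ F x * h - D ^ 2 * hw'
  rcases mul_eq_zero.1 hprod with h0 | h0
  · refine ⟨(w - y) / (2 * x), ?_⟩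
    rw [Algebra.smul_def, map_div₀, map_mul, map_sub, map_ofNat]
    field_simp
    linear_combination h0
  · refine ⟨(-w - y) / (2 * x), ?_⟩
    rw [Algebra.smul_def, map_div₀, map_mul, map_sub, map_neg, map_ofNat]
    field_simp
    linear_combination h0

theorem Proportional.mul_left {f g : F} (h : Proportional f g) (e : F) :
    Proportional (e * f) (e * g) := by
  obtain ⟨k, rfl⟩ := h
  exact ⟨k, by simp⟩

theorem proportional_mul_left_iff {e f g : F} (he : e ≠ 0) :
    Proportional (e * f) (e * g) ↔ Proportional f g := by
  refine ⟨fun ⟨k, hk⟩ => ⟨k, mul_left_cancel₀ he ?_⟩, fun h => h.mul_left e⟩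
  rw [hk, mul_smul_comm]

theorem proportional_mul_right_iff {e f g : F} (he : e ≠ 0) :
    Proportional (f * e) (g * e) ↔ Proportional f g := by
  rw [mul_comm f, mul_comm g, proportional_mul_left_iff he]

/-- The arrangements of proportional spectral products with at most six equations: the
underdetermined one, that of LSG₂ and that of LMKdV₂. -/
theorem proportional_of_finrank_le_six {A B C D Λ Ξ Γ Δ : F} (hA : A ≠ 0) (hB : B ≠ 0) (hC : C ≠ 0)
    (hD : D ≠ 0) (hΛ : Λ ≠ 0) (hΞ : Ξ ≠ 0) (hΓ : Γ ≠ 0) (hΔ : Δ ≠ 0)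
    (h : (Module.finrank ℂ (Submodule.span ℂ {A * Λ, B * Γ, C * Ξ}) +
        Module.finrank ℂ (Submodule.span ℂ {A * Ξ, B * Δ, B * Λ, D * Ξ})) +
      (Module.finrank ℂ (Submodule.span ℂ {D * Δ, C * Ξ, B * Γ}) +
        Module.finrank ℂ (Submodule.span ℂ {D * Γ, C * Λ, C * Δ, A * Γ})) ≤ 6) :
    Proportional (C * Ξ) (B * Γ) ∧
      (Proportional (A * Λ) (B * Γ) ∧ Proportional (A * Ξ) (B * Δ) ∧ Proportional (B * Λ) (D * Ξ) ∨
        Proportional A D ∧ Proportional Λ Δ ∧ Proportional (A * Λ) (B * Γ) ∧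
          ¬ Proportional (A * Ξ) (B * Λ) ∨
        Proportional A D ∧ Proportional Λ Δ ∧ Proportional (A * Ξ) (B * Λ) ∧
          ¬ Proportional (A * Λ) (B * Γ)) := by
  have hfin {S : Set F} [Finite S] : S.Finite := Set.toFinite S
  have h11 := one_le_finrank_span (S := {A * Λ, B * Γ, C * Ξ}) hfin (f := A * Λ) (by simp)
    (mul_ne_zero hA hΛ)
  have h12 := one_le_finrank_span (S := {A * Ξ, B * Δ, B * Λ, D * Ξ}) hfin (f := A * Ξ) (by simp)
    (mul_ne_zero hA hΞ)
  have h22 := one_le_finrank_span (S := {D * Δ, C * Ξ, B * Γ}) hfin (f := D * Δ) (by simp)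
    (mul_ne_zero hD hΔ)
  have h21 := one_le_finrank_span (S := {D * Γ, C * Λ, C * Δ, A * Γ}) hfin (f := D * Γ) (by simp)
    (mul_ne_zero hD hΓ)
  have hCΞ := mul_ne_zero hC hΞ
  have hBΓ := mul_ne_zero hB hΓ
  have hqr : Proportional (C * Ξ) (B * Γ) := by
    by_contra hqr
    have h1 : ¬ Module.finrank ℂ (Submodule.span ℂ {A * Λ, B * Γ, C * Ξ}) ≤ 1 := fun h1 =>
      hqr (proportional_of_finrank_span_le_one hfin h1 (by simp) (by simp) hCΞ)
    have h2 : ¬ Module.finrank ℂ (Submodule.span ℂ {D * Δ, C * Ξ, B * Γ}) ≤ 1 := fun h1 =>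
      hqr (proportional_of_finrank_span_le_one hfin h1 (by simp) (by simp) hCΞ)
    obtain ⟨x, hx⟩ : Proportional (A * Ξ) (B * Λ) := proportional_of_finrank_span_le_one
      (S := {A * Ξ, B * Δ, B * Λ, D * Ξ}) hfin (by omega) (by simp) (by simp) (mul_ne_zero hA hΞ)
    obtain ⟨y, hy⟩ : Proportional (C * Λ) (A * Γ) := proportional_of_finrank_span_le_one
      (S := {D * Γ, C * Λ, C * Δ, A * Γ}) hfin (by omega) (by simp) (by simp) (mul_ne_zero hC hΛ)
    refine hqr ⟨x * y, mul_left_cancel₀ (mul_ne_zero hA hΛ) ?_⟩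
    rw [Algebra.smul_def] at hx hy ⊢
    rw [map_mul]
    linear_combination B * Λ * hy + algebraMap ℂ F y * C * Λ * hx
  refine ⟨hqr, ?_⟩
  -- Multiplication by `C / B` maps the products of the entry `(1, 2)` to those of `(2, 1)`.
  have hle : Module.finrank ℂ (Submodule.span ℂ {A * Ξ, B * Δ, B * Λ, D * Ξ}) ≤
      Module.finrank ℂ (Submodule.span ℂ {D * Γ, C * Λ, C * Δ, A * Γ}) := by
    obtain ⟨k, hk⟩ := hqr.symm hBΓ
    have := FiniteDimensional.span_of_finite ℂ (hfin (S := {D * Γ, C * Λ, C * Δ, A * Γ}))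
    have hinj : Function.Injective (LinearMap.mulLeft ℂ (C / B)) :=
      mul_right_injective₀ (div_ne_zero hC hB)
    rw [(Submodule.equivMapOfInjective _ hinj _).finrank_eq]
    refine Submodule.finrank_mono ?_
    rw [Submodule.map_span_le]
    have hk' : C / B * Ξ = k • Γ := by
      rw [div_mul_eq_mul_div, hk, smul_div_assoc, mul_div_cancel_left₀ _ hB]
    have hmem (x y : F) (hy : y ∈ ({D * Γ, C * Λ, C * Δ, A * Γ} : Set F)) (c : ℂ)
        (hxy : x = c • y) : x ∈ Submodule.span ℂ {D * Γ, C * Λ, C * Δ, A * Γ} :=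
      hxy ▸ Submodule.smul_mem _ _ (Submodule.subset_span hy)
    rintro f (rfl | rfl | rfl | rfl)
    · refine hmem _ (A * Γ) (by simp) k ?_
      rw [LinearMap.mulLeft_apply, mul_left_comm, hk', mul_smul_comm]
    · refine hmem _ (C * Δ) (by simp) 1 ?_
      rw [LinearMap.mulLeft_apply, one_smul]
      field_simp
    · refine hmem _ (C * Λ) (by simp) 1 ?_
      rw [LinearMap.mulLeft_apply, one_smul]
      field_simp
    · refine hmem _ (D * Γ) (by simp) k ?_
      rw [LinearMap.mulLeft_apply, mul_left_comm, hk', mul_smul_comm]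
  by_cases h1 : Module.finrank ℂ (Submodule.span ℂ {A * Ξ, B * Δ, B * Λ, D * Ξ}) ≤ 1
  · have hAD : Proportional A D := (proportional_mul_right_iff hΞ).1
      (proportional_of_finrank_span_le_one hfin h1 (by simp) (by simp) (mul_ne_zero hA hΞ))
    have hΛΔ : Proportional Λ Δ := (proportional_mul_left_iff hB).1
      (proportional_of_finrank_span_le_one hfin h1 (by simp) (by simp) (mul_ne_zero hB hΛ))
    have hAB : Proportional (A * Ξ) (B * Λ) :=
      proportional_of_finrank_span_le_one hfin h1 (by simp) (by simp) (mul_ne_zero hA hΞ)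
    by_cases hpq : Proportional (A * Λ) (B * Γ)
    · exact .inl ⟨hpq, hAB.trans (hΛΔ.mul_left B),
        proportional_of_finrank_span_le_one hfin h1 (by simp) (by simp) (mul_ne_zero hB hΛ)⟩
    · exact .inr (.inr ⟨hAD, hΛΔ, hAB, hpq⟩)
  · have hpq : Proportional (A * Λ) (B * Γ) := proportional_of_finrank_span_le_one
      (S := {A * Λ, B * Γ, C * Ξ}) hfin (by omega) (by simp) (by simp) (mul_ne_zero hA hΛ)
    have hqt : Proportional (B * Γ) (D * Δ) := proportional_of_finrank_span_le_one
      (S := {D * Δ, C * Ξ, B * Γ}) hfin (by omega) (by simp) (by simp) hBΓ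
    have hpt := hpq.trans hqt
    by_cases hAD : Proportional A D
    · have hΛΔ : Proportional Λ Δ := by
        have hDA := (proportional_mul_right_iff hΔ).2 (hAD.symm hD)
        exact (proportional_mul_left_iff hA).1 (hpt.trans hDA)
      refine .inr (.inl ⟨hAD, hΛΔ, hpq, fun hAB => h1 ?_⟩)
      refine finrank_span_le_one (f := A * Ξ) ?_
      simp only [Set.mem_insert_iff, Set.mem_singleton_iff, forall_eq_or_imp, forall_eq]
      exact ⟨.refl _, hAB.trans (hΛΔ.mul_left B), hAB, (proportional_mul_right_iff hΞ).2 hAD⟩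
    · -- `B Λ` and `B Δ` are combinations of `A Ξ` and `D Ξ`, and `A Λ` is proportional to `D Δ`.
      -- Eliminating `Λ` and `Δ` gives a quadratic equation over `ℂ` for the non-constant `A / D`.
      left
      have hXY : ¬ Proportional (A * Ξ) (D * Ξ) := by rwa [proportional_mul_right_iff hΞ]
      have hX0 := mul_ne_zero hA hΞ
      have h2 : Module.finrank ℂ (Submodule.span ℂ {A * Ξ, B * Δ, B * Λ, D * Ξ}) ≤ 2 := by omega
      obtain ⟨x, y, hZ⟩ := exists_combination_of_finrank_span_le_two hfin h2 (f := A * Ξ)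
        (g := D * Ξ) (h := B * Λ) (by simp) (by simp) (by simp) hX0 hXY
      obtain ⟨z, t, hW⟩ := exists_combination_of_finrank_span_le_two hfin h2 (f := A * Ξ)
        (g := D * Ξ) (h := B * Δ) (by simp) (by simp) (by simp) hX0 hXY
      obtain ⟨k, hk⟩ := hpt
      have hk0 : k ≠ 0 := by
        rintro rfl
        simp [hD, hΔ] at hk
      have hquad : (k * x) • (A * A) + (k * y - z) • (A * D) + (-t) • (D * D) = 0 := by
        refine mul_left_cancel₀ hΞ ?_
        simp only [Algebra.smul_def, map_mul, map_sub, map_neg] at hZ hW hk ⊢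
        linear_combination algebraMap ℂ F k * A * hZ - D * hW - B * hk
      have hx0 : x = 0 := by
        by_contra hx0
        exact hAD ((proportional_of_quadratic (mul_ne_zero hk0 hx0) hquad).symm hA)
      subst hx0
      have hzt : (k * y - z) • A + (-t) • D = 0 := by
        refine mul_right_cancel₀ hD ?_
        simp only [Algebra.smul_def, mul_zero, map_zero] at hquad ⊢
        linear_combination hquad
      have ht := (eq_zero_of_not_proportional hA hAD hzt).2
      refine ⟨hpq, ⟨z, ?_⟩, Proportional.symm ⟨y, ?_⟩ (mul_ne_zero hB hΛ)⟩
      · rw [← hW, neg_eq_zero.1 ht, zero_smul, add_zero]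
      · rw [← hZ, zero_smul, zero_add]

/-! ### Reducible systems -/

theorem reducibleTo_LSG2 {s : Slot → F} (hs : ∀ k, s k ≠ 0)
    (hAD : Proportional (s (.inl (0, 0))) (s (.inl (1, 1))))
    (hΛΔ : Proportional (s (.inr (0, 0))) (s (.inr (1, 1))))
    (hbγ : Proportional (s (.inl (0, 0)) * s (.inr (0, 0))) (s (.inl (0, 1)) * s (.inr (1, 0))))
    (hcβ : Proportional (s (.inl (0, 0)) * s (.inr (0, 0))) (s (.inl (1, 0)) * s (.inr (0, 1))))
    (hind : ¬ Proportional (s (.inl (0, 0)) * s (.inr (0, 1)))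
      (s (.inl (0, 1)) * s (.inr (0, 0)))) : ReducibleTo s LSG2 lsg2Terms := by
  have hs2 (k l : Slot) : s k * s l ≠ 0 := mul_ne_zero (hs k) (hs l)
  obtain ⟨k₁, hk₁, h1⟩ := hAD.exists_smul_eq (hs _)
  obtain ⟨k₂, hk₂, h2⟩ := hΛΔ.exists_smul_eq (hs _)
  obtain ⟨k₃, hk₃, h3⟩ := hbγ.exists_smul_eq (hs2 _ _)
  obtain ⟨k₄, hk₄, h4⟩ := hcβ.exists_smul_eq (hs2 _ _)
  have hκ : ∀ k, slots 1 k₃ k₄ k₁ 1 1 1 k₂ k ≠ 0 :=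
    slots_ne_zero one_ne_zero hk₃ hk₄ hk₁ one_ne_zero one_ne_zero one_ne_zero hk₂
  refine ReducibleTo.of_smul hκ (IsLSG2Spectral.isSolution_iff
    ⟨fun k => smul_ne_zero (hκ k) (hs k), ?_, ?_, ?_, ?_, ?_⟩)
  · simpa [slots] using h1
  · simpa [slots] using h2
  · simpa [slots] using h3
  · simpa [slots] using h4
  · rintro ⟨k, hk⟩
    have hk' : k₃ • (s (.inl (0, 1)) * s (.inr (0, 0))) =
        k • (s (.inl (0, 0)) * s (.inr (0, 1))) := by simpa [slots] using hk
    exact hind ⟨k₃⁻¹ * k, by rw [mul_smul, ← hk', inv_smul_smul₀ hk₃]⟩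

theorem reducibleTo_LMKdV2 {s : Slot → F} (hs : ∀ k, s k ≠ 0)
    (hAD : Proportional (s (.inl (0, 0))) (s (.inl (1, 1))))
    (hΛΔ : Proportional (s (.inr (0, 0))) (s (.inr (1, 1))))
    (haβ : Proportional (s (.inl (0, 0)) * s (.inr (0, 1))) (s (.inl (0, 1)) * s (.inr (0, 0))))
    (hcβ : Proportional (s (.inl (1, 0)) * s (.inr (0, 1))) (s (.inl (0, 1)) * s (.inr (1, 0))))
    (hind : ¬ Proportional (s (.inl (0, 0)) * s (.inr (0, 0)))
      (s (.inl (0, 1)) * s (.inr (1, 0)))) : ReducibleTo s LMKdV2 lmkdv2Terms := by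
  have hs2 (k l : Slot) : s k * s l ≠ 0 := mul_ne_zero (hs k) (hs l)
  obtain ⟨k₁, hk₁, h1⟩ := hAD.exists_smul_eq (hs _)
  obtain ⟨k₂, hk₂, h2⟩ := hΛΔ.exists_smul_eq (hs _)
  obtain ⟨k₃, hk₃, h3⟩ := (haβ.symm (hs2 _ _)).exists_smul_eq (hs2 _ _)
  obtain ⟨k₄, hk₄, h4⟩ := (hcβ.symm (hs2 _ _)).exists_smul_eq (hs2 _ _)
  have hκ : ∀ k, slots 1 1 (k₄ / k₃) k₁ 1 k₃ 1 k₂ k ≠ 0 :=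
    slots_ne_zero one_ne_zero one_ne_zero (div_ne_zero hk₄ hk₃) hk₁ one_ne_zero hk₃ one_ne_zero hk₂
  refine ReducibleTo.of_smul hκ (IsLMKdV2Spectral.isSolution_iff
    ⟨fun k => smul_ne_zero (hκ k) (hs k), ?_, ?_, ?_, ?_, ?_⟩)
  · simpa [slots] using h1
  · simpa [slots] using h2
  · simpa [slots, smul_smul, mul_div_cancel₀ k₄ hk₃] using h4
  · simpa [slots] using h3
  · simpa [slots] using hind

end LaxClass

theorem theorem1 {F : Type*} [Field F] [Algebra ℂ F] (s : LaxClass.Slot → F)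
    (hs : ∀ k, s k ≠ 0) :
    LaxClass.Trivial s ∨ LaxClass.Underdetermined s ∨ LaxClass.Overdetermined s ∨
      LaxClass.ReducibleTo s LaxClass.LSG2 LaxClass.lsg2Terms ∨
      LaxClass.ReducibleTo s LaxClass.LMKdV2 LaxClass.lmkdv2Terms := by
  open LaxClass in
  by_cases h : 6 < numEquations s
  · exact .inr (.inr (.inl (overdetermined_of_lt_numEquations hs h)))
  rw [not_lt, numEquations_eq] at h
  obtain ⟨hqr, ⟨hpq, hXW, hZY⟩ | ⟨hAD, hΛΔ, hpq, hXZ⟩ | ⟨hAD, hΛΔ, hXZ, hpq⟩⟩ :=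
    proportional_of_finrank_le_six (hs _) (hs _) (hs _) (hs _) (hs _) (hs _) (hs _) (hs _) h
  · exact .inr (.inl (underdetermined_of_proportional hs hpq
      (hpq.trans (hqr.symm (mul_ne_zero (hs _) (hs _)))) hXW hZY))
  · exact .inr (.inr (.inr (.inl (reducibleTo_LSG2 hs hAD hΛΔ hpq
      (hpq.trans (hqr.symm (mul_ne_zero (hs _) (hs _)))) hXZ))))
  · exact .inr (.inr (.inr (.inr (reducibleTo_LMKdV2 hs hAD hΛΔ hXZ hqr hpq))))
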